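/- Let $d\ge 0$, $k\ge 1$. A line in $\mathbb R^d$ is a pair $(x,\theta)\in\mathbb R^d\times\mathbb S^{d-1}$, parameterized by $t\mapsto x+t\theta$, and $\mathbb L^d_k=(\mathbb R^d\times\mathbb S^{d-1})^k$ is the space of systems of $k$ lines. Let $\mathrm E(d)$ be the group of maps $g\colon y\mapsto Qy+a$ with $Q\in \mathrm O(d)$, $a\in\mathbb R^d$; it acts on lines by $g(x,\theta)=(Qx+a,Q\theta)$, and line by line on $\mathbb L^d_k$. Fix a tree $G$ with vertex set $\{1,\dots,k\}$. A tree system $\mathcal L$ with tree structure $G$ consists of lines $(x_i,\theta_i)_{i=1}^k\in\mathbb L^d_k$ and, for every edge $ij$ of $G$, a common point $x_i+s_{ij}\theta_i=x_j+s_{ji}\theta_j$ of the lines $i$ and $j$, at which these are glued together (put $s_{ij}=0$ if $ij$ is not an edge). Tree systems carry the topology of the data $(x_i,\theta_i,s_{ij})$, and $\mathrm E(d)$ acts on them through the lines, the parameters $s_{ij}$ being unchanged. The tree metric $d_{\mathcal L}$ on the disjoint union $\bar{\mathcal L}=\{1,\dots,k\}\times\mathbb R$ of the lines is the length of the shortest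 route that changes lines only at gluing points (glued points have distance $0$). Let $\alpha\colon\mathbb R^d\times\mathbb L^d_k\to\Delta_{k-1}$ be continuous and $\mathrm E(d)$-invariant: $\alpha(gy,g\mathcal L)=\alpha(y,\mathcal L)$ for all $g,y,\mathcal L$. For a probability measure $\mu$ on $\mathbb R^d$ let $\mathcal R^\alpha_{\mathcal L}\mu$ be the probability measure on $\bar{\mathcal L}$ whose restriction to line $i$ is the image of the measure $\alpha(y,\mathcal L)_i\,d\mu(y)$ under $y\mapsto\langle y-x_i,\theta_i\rangle$. Let $\mathrm W_{d_{\mathcal L},1}$ be the $1$-Wasserstein distance (infimum of the transport cost over couplings) with ground metric $d_{\mathcal L}$. For a Borel measure $\sigma$ on the space of tree systems with structure $G$ put $$\text{Db-TSW}(\mu,\nu)=\int \mathrm W_{d_{\mathcal L},1}(\mathcal R^\alpha_{\mathcal L}\mu,\mathcal R^\alpha_{\mathcal L}\nu)\,d\sigma(\mathcal L)\in[0,\infty].$$ Suppose that the support of $\sigma$ contains a set $\mathbb T$ of tree systems such that either (a) $\mathbb T$ is non-empty and closed under the action of $\mathrm E(d)$, or (b) for every $\theta\in\mathbb S^{d-1}$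 there is an $\mathcal L\in\mathbb T$ all of whose lines have direction $\theta$. Then: 1. Db-TSW is a metric, with values in $[0,\infty]$, on the set $\mathcal P(\mathbb R^d)$ of Borel probability measures: $\text{Db-TSW}(\mu,\nu)=0$ if and only if $\mu=\nu$, it is symmetric, and it satisfies the triangle inequality. 2. If $\sigma$ is finite and $\int\bigl(\sum_i\|x_i\|+\sum_{i,j}|s_{ij}|\bigr)d\sigma<\infty$, then $\text{Db-TSW}(\mu,\nu)<\infty$ for all $\mu,\nu$ with finite first moment. 3. For every $g\in \mathrm E(d)$ with $g\sharp\sigma=\sigma$ one has $\text{Db-TSW}(g\sharp\mu,g\sharp\nu)=\text{Db-TSW}(\mu,\nu)$ for all $\mu,\nu\in\mathcal P(\mathbb R^d)$. In particular, Db-TSW is $\mathrm E(d)$-invariant if $\sigma$ is. -/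

import Mathlib

open MeasureTheory

open scoped ENNReal

noncomputable section

namespace TreeSliced

/-- Euclidean space `ℝ^d`. -/
abbrev Space (d : ℕ) : Type := EuclideanSpace ℝ (Fin d)

/-- A line `(x, θ) ∈ ℝ^d × S^{d-1}` with source `x` and direction `θ`,
parameterized by `t ↦ x + t θ`. -/
abbrev Line (d : ℕ) : Type := Space d × Metric.sphere (0 : Space d) 1

/-- The space `(ℝ^d × S^{d-1})^k` of systems of `k` lines. -/
abbrev LineSystem (d k : ℕ) : Type := Fin k → Line d

/-- The Euclidean group `E(d)`: maps `y ↦ Q y + a` with `Q` orthogonal. -/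
abbrev EuclideanGroup (d : ℕ) : Type := Space d ≃ᵃⁱ[ℝ] Space d

/-- The action `(x, θ) ↦ (Q x + a, Q θ)` of `g = (Q, a)` on lines. -/
def actLine {d : ℕ} (g : EuclideanGroup d) (l : Line d) : Line d :=
  (g l.1, ⟨g.linearIsometryEquiv l.2, by
    have h := l.2.2
    rw [mem_sphere_zero_iff_norm] at h ⊢
    rw [LinearIsometryEquiv.norm_map, h]⟩)

/-- The action of `E(d)` on systems of lines, line by line. -/
def actLines {d k : ℕ} (g : EuclideanGroup d) (L : LineSystem d k) : LineSystem d k :=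
  fun i => actLine g (L i)

/-- A splitting map is a continuous map `ℝ^d × (ℝ^d × S^{d-1})^k → Δ_{k-1}`. -/
abbrev SplittingMap (d k : ℕ) : Type := C(Space d × LineSystem d k, stdSimplex ℝ (Fin k))

/-- `E(d)`-invariance of a splitting map: `α(gy, gL) = α(y, L)`. -/
def SplittingMap.IsInvariant {d k : ℕ} (α : SplittingMap d k) : Prop :=
  ∀ (g : EuclideanGroup d) (y : Space d) (L : LineSystem d k),
    α (g y, actLines g L) = α (y, L)

/-- Tree systems of `k` lines with tree structure `G` (a graph on the indices of the lines, used
when `G` is a tree). Besides the lines, a tree system records at which of their intersection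
points neighbouring lines are glued: for adjacent `i`, `j`, the point of line `i` with parameter
`s i j` is the point of line `j` with parameter `s j i`. (If neighbouring lines coincide as
subsets of `ℝ^d`, this is a choice.) The entries `s i j` for non-adjacent `i`, `j` are not used
and are set to `0`. -/
abbrev TreeSystem (d : ℕ) {k : ℕ} (G : SimpleGraph (Fin k)) : Type :=
  {p : LineSystem d k × (Fin k → Fin k → ℝ) //
    (∀ i j, G.Adj i j →
      (p.1 i).1 + p.2 i j • ((p.1 i).2 : Space d) =
        (p.1 j).1 + p.2 j i • ((p.1 j).2 : Space d)) ∧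
    ∀ i j, ¬ G.Adj i j → p.2 i j = 0}

variable {d k : ℕ} {G : SimpleGraph (Fin k)}

/-- The underlying system of lines. -/
def TreeSystem.lines (L : TreeSystem d G) : LineSystem d k := L.1.1

/-- The parameter, on line `i`, of the point where line `i` is glued to line `j`. -/
def TreeSystem.param (L : TreeSystem d G) (i j : Fin k) : ℝ := L.1.2 i j

/-- The action of `E(d)` on tree systems: it moves the lines, and the gluing points with them, so
that the parameters of the gluing points do not change. -/
def TreeSystem.act (g : EuclideanGroup d) (L : TreeSystem d G) : TreeSystem d G :=
  ⟨(actLines g L.1.1, L.1.2), by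
    refine ⟨fun i j hij => ?_, L.2.2⟩
    have key : ∀ (l : Line d) (t : ℝ),
        (actLine g l).1 + t • ((actLine g l).2 : Space d) = g (l.1 + t • (l.2 : Space d)) := by
      intro l t
      have h := g.map_vadd l.1 (t • (l.2 : Space d))
      simp only [vadd_eq_add, map_smul] at h
      rw [add_comm l.1, h, add_comm]
      rfl
    show (actLine g (L.1.1 i)).1 + L.1.2 i j • ((actLine g (L.1.1 i)).2 : Space d) =
      (actLine g (L.1.1 j)).1 + L.1.2 j i • ((actLine g (L.1.1 j)).2 : Space d)
    rw [key, key, L.2.1 i j hij]⟩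

/-- The ground set of a system of `k` lines, the disjoint union of the lines: `(i, t)` stands for
the point `x_i + t θ_i` of line `i`. -/
abbrev Ground (k : ℕ) : Type := Fin k × ℝ

/-- Length of the route that starts at parameter `t` on line `i`, changes lines along the walk
through the gluing points, and ends at parameter `t'` on line `j`. -/
def TreeSystem.routeLength (L : TreeSystem d G) : {i j : Fin k} → G.Walk i j → ℝ → ℝ → ℝ≥0∞
  | _, _, .nil, t, t' => edist t t'
  | i, _, .cons (v := m) _ w, t, t' =>
      edist t (L.param i m) + L.routeLength w (L.param m i) t'

/-- The tree metric `d_L` on the ground set: length of a shortest route. Points that are glued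
together have distance `0`. -/
def TreeSystem.treeDist (L : TreeSystem d G) (p q : Ground k) : ℝ≥0∞ :=
  ⨅ w : G.Walk p.1 q.1, L.routeLength w p.2 q.2

/-- The Radon transform `R^α_L μ`, a measure on the ground set of the system: the part
`α(y, L)_i dμ(y)` of the mass is projected to line `i`, where `y` goes to the parameter
`⟨y - x_i, θ_i⟩`. -/
def radon (α : SplittingMap d k) (L : LineSystem d k) (μ : Measure (Space d)) :
    Measure (Ground k) :=
  ∑ i, (μ.withDensity fun y => ENNReal.ofReal ((α (y, L)).1 i)).map
    fun y => (i, inner ℝ (y - (L i).1) ((L i).2 : Space d))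

/-- The `1`-Wasserstein distance with ground distance `c`: the infimum of the transport cost over
all couplings of `P` and `Q`. -/
def wasserstein {Z : Type} [MeasurableSpace Z] (c : Z → Z → ℝ≥0∞) (P Q : Measure Z) : ℝ≥0∞ :=
  ⨅ (π : Measure (Z × Z)) (_ : π.map Prod.fst = P) (_ : π.map Prod.snd = Q),
    ∫⁻ z, c z.1 z.2 ∂π

/-- The Distance-based Tree-Sliced Wasserstein distance with values in `[0, ∞]`. -/
def dbTSW (α : SplittingMap d k) (σ : Measure (TreeSystem d G))
    (μ ν : ProbabilityMeasure (Space d)) : ℝ≥0∞ :=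
  ∫⁻ L, wasserstein L.treeDist
    (radon α L.lines (μ : Measure (Space d))) (radon α L.lines (ν : Measure (Space d))) ∂σ

/-- The pushforward of a probability measure by a Euclidean transformation. -/
def push (g : EuclideanGroup d) (μ : ProbabilityMeasure (Space d)) :
    ProbabilityMeasure (Space d) :=
  μ.map g.continuous.measurable.aemeasurable

end TreeSliced

end

noncomputable section

namespace TreeSliced

open Filter Topology
open scoped NNReal ProbabilityTheory

variable {d k : ℕ} {G : SimpleGraph (Fin k)}

/-! ### Routes and the tree metric -/

/-! The one deep point is that vanishing distance forces `μ = ν`. Write `W(L)` for the Wasserstein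
distance of the two Radon transforms on `L`. It is lower semicontinuous in `L`
(`lowerSemicontinuous_wasserstein`), because the transforms depend weakly continuously on `L`, the
tree metric is jointly continuous, and couplings of convergent marginals are tight. So if its
integral is `0`, then `W` vanishes on the whole support, not only almost everywhere. By
`integral_eq_of_wasserstein_eq_zero` the two transforms then agree on all bounded functions that are
Lipschitz on each line and match at the gluing points. It remains to recover the characteristic
functions, that is, the integrals of `exp (i r ⟨y, φ⟩)` for all unit vectors `φ`.

If all lines of `L` have direction `φ`, this wave restricts to an admissible test function on the
lines. Projecting `y` to a line does not change `⟨y, φ⟩`, so the weights `α_i` sum out to `1`.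

For an orbit of `E(d)`, moving the system by `g⁻¹` amounts to moving the measures by `g`
(`wasserstein_act`). A wave on line `i`, cut off at the gluing points, is admissible. It shows that
the complex measure `exp (i r ⟨y, φ⟩) d(μ - ν)(y)` is orthogonal to all translates of one
nonnegative bounded continuous function that is not identically `0`. Normalized averages of such
translates converge boundedly to `1` (`tendsto_integral_translateAvg`), so this measure has total
mass `0`.

The other claims are softer. The triangle inequality comes from gluing couplings. Finiteness comes
from the product coupling, since the tree metric grows at most linearly. Invariance is a change of
variables in the integral over `σ`. -/

lemma TreeSystem.routeLength_nil (L : TreeSystem d G) (i : Fin k) (t t' : ℝ) :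
    L.routeLength (.nil : G.Walk i i) t t' = edist t t' := rfl

lemma TreeSystem.routeLength_cons (L : TreeSystem d G) {i m j : Fin k} (h : G.Adj i m)
    (w : G.Walk m j) (t t' : ℝ) :
    L.routeLength (.cons h w) t t' = edist t (L.param i m) + L.routeLength w (L.param m i) t' :=
  rfl

lemma TreeSystem.routeLength_le_edist_add (L : TreeSystem d G) {i j : Fin k} (w : G.Walk i j)
    (t r t' : ℝ) : L.routeLength w t t' ≤ edist t r + L.routeLength w r t' := by
  cases w with
  | nil => exact edist_triangle _ _ _
  | cons h w =>
    simp only [routeLength_cons, ← add_assoc]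
    gcongr
    exact edist_triangle _ _ _

/-- The witness `r` is the parameter at which the first walk enters its last line, or `t` itself if
that walk is trivial. -/
lemma TreeSystem.exists_routeLength_append (L : TreeSystem d G) {i j l : Fin k} (w : G.Walk i j)
    (w' : G.Walk j l) (t t' : ℝ) :
    ∃ r, L.routeLength (w.append w') t t' = L.routeLength w t r + L.routeLength w' r t' := by
  induction w generalizing t with
  | nil => exact ⟨t, by simp [routeLength_nil]⟩
  | cons h w ih =>
    obtain ⟨r, hr⟩ := ih w' _
    exact ⟨r, by rw [SimpleGraph.Walk.cons_append, routeLength_cons, hr, routeLength_cons,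
      add_assoc]⟩

lemma TreeSystem.routeLength_append_le (L : TreeSystem d G) {i j l : Fin k} (w : G.Walk i j)
    (w' : G.Walk j l) (t r t' : ℝ) :
    L.routeLength (w.append w') t t' ≤ L.routeLength w t r + L.routeLength w' r t' := by
  induction w generalizing t with
  | nil => exact L.routeLength_le_edist_add w' t r t'
  | cons h w ih =>
    rw [SimpleGraph.Walk.cons_append, routeLength_cons, routeLength_cons, add_assoc]
    gcongr
    exact ih _ _

lemma TreeSystem.routeLength_reverse_le (L : TreeSystem d G) {i j : Fin k} (w : G.Walk i j)
    (t t' : ℝ) : L.routeLength w.reverse t' t ≤ L.routeLength w t t' := by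
  induction w generalizing t with
  | nil => simp [routeLength_nil, edist_comm]
  | @cons i m j h w ih =>
    rw [SimpleGraph.Walk.reverse_cons, routeLength_cons]
    refine (L.routeLength_append_le _ _ _ (L.param m i) _).trans ?_
    rw [routeLength_cons, routeLength_nil, edist_self, zero_add, add_comm, edist_comm t]
    gcongr
    exact ih _

/-- A function on the lines which is Lipschitz on each of them and respects the gluing does not
vary faster than the length of the route. -/
lemma TreeSystem.edist_le_mul_routeLength (L : TreeSystem d G) {E : Type*} [PseudoEMetricSpace E]
    {H : Fin k → ℝ → E} {K : ℝ≥0} (hH : ∀ i, LipschitzWith K (H i))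
    (hglue : ∀ i j, G.Adj i j → H i (L.param i j) = H j (L.param j i))
    {i j : Fin k} (w : G.Walk i j) (t t' : ℝ) :
    edist (H i t) (H j t') ≤ K * L.routeLength w t t' := by
  induction w generalizing t with
  | nil => exact hH _ _ _
  | @cons i m j h w ih =>
    rw [routeLength_cons, mul_add]
    refine (edist_triangle _ (H i (L.param i m)) _).trans ?_
    gcongr
    · exact hH _ _ _
    · rw [hglue i m h]
      exact ih _

/-- The route along a line is the shortest one between points of that line. -/
lemma TreeSystem.edist_le_routeLength (L : TreeSystem d G) {i : Fin k} (w : G.Walk i i)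
    (t t' : ℝ) : edist t t' ≤ L.routeLength w t t' := by
  -- The lines embed isometrically into `ℝ^d`, compatibly with the gluing, so the Lipschitz bound
  -- applies with constant `1`.
  have hiso : ∀ i, Isometry fun t : ℝ => (L.lines i).1 + t • ((L.lines i).2 : Space d) := by
    intro i
    refine Isometry.of_dist_eq fun a b => ?_
    rw [dist_add_left, dist_eq_norm, ← sub_smul, norm_smul, norm_eq_of_mem_sphere, mul_one,
      Real.dist_eq, Real.norm_eq_abs]
  have h := L.edist_le_mul_routeLength (fun i => (hiso i).lipschitz) (fun i j h => L.2.1 i j h) w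
    t t'
  rwa [ENNReal.coe_one, one_mul, (hiso i).edist_eq] at h

/-- Bypassing cuts out closed walks. A closed walk based at line `i` that returns there at parameter
`r` costs at least the direct way from `t` to `r` along the line. -/
lemma TreeSystem.routeLength_bypass_le (L : TreeSystem d G) {i j : Fin k} (w : G.Walk i j)
    (t t' : ℝ) : L.routeLength w.bypass t t' ≤ L.routeLength w t t' := by
  induction w generalizing t with
  | nil => exact le_rfl
  | @cons i m j h w ih =>
    have hle : L.routeLength (.cons h w.bypass) t t' ≤ L.routeLength (.cons h w) t t' := by
      rw [routeLength_cons, routeLength_cons]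
      gcongr
      exact ih _
    refine le_trans ?_ hle
    rw [SimpleGraph.Walk.bypass]
    split_ifs with hs
    · obtain ⟨r, hr⟩ := L.exists_routeLength_append (.cons h (w.bypass.takeUntil i hs))
        (w.bypass.dropUntil i hs) t t'
      rw [SimpleGraph.Walk.cons_append, SimpleGraph.Walk.take_spec] at hr
      rw [hr]
      refine (L.routeLength_le_edist_add _ t r t').trans ?_
      gcongr
      exact L.edist_le_routeLength _ _ _
    · exact le_rfl

/-- In a tree the shortest route runs along the path. -/
lemma TreeSystem.treeDist_eq_routeLength (hG : G.IsTree) (L : TreeSystem d G) {i j : Fin k}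
    (w : G.Walk i j) (hw : w.IsPath) (t t' : ℝ) :
    L.treeDist (i, t) (j, t') = L.routeLength w t t' := by
  refine le_antisymm (iInf_le _ w) (le_iInf fun w' => ?_)
  have h := congrArg Subtype.val ((hG.isAcyclic.subsingleton_path i j).elim ⟨w, hw⟩
    ⟨w'.bypass, w'.bypass_isPath⟩)
  simp only at h
  rw [h]
  exact L.routeLength_bypass_le w' t t'

lemma exists_isPath (hG : G.IsTree) (i j : Fin k) : ∃ w : G.Walk i j, w.IsPath := by
  obtain ⟨w⟩ := hG.connected.preconnected i j
  exact ⟨w.bypass, w.bypass_isPath⟩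

/-- A function on the lines which is Lipschitz on each of them and respects the gluing is
Lipschitz for the tree metric. -/
lemma TreeSystem.edist_le_mul_treeDist (hG : G.IsTree) (L : TreeSystem d G) {E : Type*}
    [PseudoEMetricSpace E] {H : Fin k → ℝ → E} {K : ℝ≥0} (hH : ∀ i, LipschitzWith K (H i))
    (hglue : ∀ i j, G.Adj i j → H i (L.param i j) = H j (L.param j i)) (p q : Ground k) :
    edist (H p.1 p.2) (H q.1 q.2) ≤ K * L.treeDist p q := by
  obtain ⟨w, hw⟩ := exists_isPath hG p.1 q.1
  rw [L.treeDist_eq_routeLength hG w hw p.2 q.2]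
  exact L.edist_le_mul_routeLength hH hglue w _ _

lemma TreeSystem.treeDist_self (L : TreeSystem d G) (p : Ground k) : L.treeDist p p = 0 :=
  le_antisymm ((iInf_le _ .nil).trans_eq (edist_self _)) (zero_le)

lemma TreeSystem.treeDist_comm (L : TreeSystem d G) (p q : Ground k) :
    L.treeDist p q = L.treeDist q p := by
  have h : ∀ p q : Ground k, L.treeDist p q ≤ L.treeDist q p := fun p q =>
    le_iInf fun w => (iInf_le _ w.reverse).trans (L.routeLength_reverse_le w _ _)
  exact le_antisymm (h p q) (h q p)

lemma TreeSystem.treeDist_triangle (L : TreeSystem d G) (p q r : Ground k) :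
    L.treeDist p r ≤ L.treeDist p q + L.treeDist q r := by
  rw [treeDist, treeDist, treeDist, ENNReal.iInf_add]
  refine le_iInf fun w => ?_
  rw [ENNReal.add_iInf]
  exact le_iInf fun w' => (iInf_le _ (w.append w')).trans (L.routeLength_append_le w w' _ _ _)

lemma TreeSystem.continuous_param (i j : Fin k) :
    Continuous fun L : TreeSystem d G => L.param i j :=
  (continuous_apply_apply i j).comp (continuous_snd.comp continuous_subtype_val)

lemma TreeSystem.continuous_lines : Continuous fun L : TreeSystem d G => L.lines :=
  continuous_fst.comp continuous_subtype_val

lemma TreeSystem.continuous_routeLength {X : Type*} [TopologicalSpace X] {i j : Fin k}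
    (w : G.Walk i j) {L : X → TreeSystem d G} {t t' : X → ℝ} (hL : Continuous L)
    (ht : Continuous t) (ht' : Continuous t') :
    Continuous fun x => (L x).routeLength w (t x) (t' x) := by
  induction w generalizing t with
  | nil => exact ht.edist ht'
  | @cons i m j h w ih =>
    exact (ht.edist ((continuous_param i m).comp hL)).add
      (ih ((continuous_param m i).comp hL))

/-- In a tree the infimum over infinitely many walks is the length along a single path. That path
depends only on the two line indices, which are locally constant. -/
lemma TreeSystem.continuous_treeDist (hG : G.IsTree) :
    Continuous fun x : TreeSystem d G × Ground k × Ground k => x.1.treeDist x.2.1 x.2.2 := by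
  choose w hw using exists_isPath hG
  have key : ∀ i j : Fin k, Continuous fun x : TreeSystem d G × ℝ × ℝ =>
      x.1.treeDist (i, x.2.1) (j, x.2.2) := fun i j => by
    simp only [fun x : TreeSystem d G × ℝ × ℝ =>
      x.1.treeDist_eq_routeLength hG (w i j) (hw i j) x.2.1 x.2.2]
    exact continuous_routeLength _ continuous_fst (by fun_prop) (by fun_prop)
  rw [continuous_iff_continuousAt]
  rintro ⟨L, ⟨i, t⟩, ⟨j, t'⟩⟩
  have hc : ContinuousAt (fun x : TreeSystem d G × Ground k × Ground k =>
      x.1.treeDist (i, x.2.1.2) (j, x.2.2.2)) (L, (i, t), (j, t')) :=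
    ((key i j).comp (f := fun x : TreeSystem d G × Ground k × Ground k =>
      (x.1, x.2.1.2, x.2.2.2)) (by fun_prop)).continuousAt
  refine hc.congr ?_
  have h1 : ∀ᶠ x : TreeSystem d G × Ground k × Ground k in 𝓝 (L, (i, t), (j, t')),
      x.2.1.1 = i :=
    (isOpen_discrete {i}).preimage (f := fun x : TreeSystem d G × Ground k × Ground k => x.2.1.1)
      (by fun_prop) |>.mem_nhds rfl
  have h2 : ∀ᶠ x : TreeSystem d G × Ground k × Ground k in 𝓝 (L, (i, t), (j, t')),
      x.2.2.1 = j :=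
    (isOpen_discrete {j}).preimage (f := fun x : TreeSystem d G × Ground k × Ground k => x.2.2.1)
      (by fun_prop) |>.mem_nhds rfl
  filter_upwards [h1, h2] with x hx1 hx2
  obtain ⟨L', ⟨i', s⟩, ⟨j', s'⟩⟩ := x
  simp only at hx1 hx2
  subst hx1 hx2
  rfl

/-- The length of a route is at most linear in its parameters. -/
lemma TreeSystem.routeLength_le (L : TreeSystem d G) {i j : Fin k} (w : G.Walk i j) (t t' : ℝ) :
    L.routeLength w t t' ≤
      ‖t‖ₑ + ‖t'‖ₑ + (2 * w.length : ℕ) * ∑ a, ∑ b, ‖L.param a b‖ₑ := by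
  have hed : ∀ a b : ℝ, edist a b ≤ ‖a‖ₑ + ‖b‖ₑ := fun a b => by
    rw [edist_eq_enorm_sub]
    exact enorm_sub_le
  have hs : ∀ a b, ‖L.param a b‖ₑ ≤ ∑ a, ∑ b, ‖L.param a b‖ₑ := fun a b =>
    (Finset.single_le_sum (f := fun b => ‖L.param a b‖ₑ) (fun _ _ => zero_le)
      (Finset.mem_univ b)).trans
    (Finset.single_le_sum (f := fun a => ∑ b, ‖L.param a b‖ₑ) (fun _ _ => zero_le)
      (Finset.mem_univ a))
  induction w generalizing t with
  | nil => simpa [routeLength_nil] using hed t t'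
  | @cons i m j h w ih =>
    rw [routeLength_cons, SimpleGraph.Walk.length_cons]
    set S := ∑ a, ∑ b, ‖L.param a b‖ₑ
    calc edist t (L.param i m) + L.routeLength w (L.param m i) t'
        ≤ (‖t‖ₑ + S) + (S + ‖t'‖ₑ + (2 * w.length : ℕ) * S) := by
          gcongr
          · exact (hed _ _).trans (by gcongr; exact hs _ _)
          · exact (ih _).trans (by gcongr; exact hs _ _)
      _ = _ := by push_cast; ring

/-! ### The Wasserstein distance -/

section Wasserstein

variable {Z : Type} [MeasurableSpace Z]

lemma wasserstein_le_lintegral (c : Z → Z → ℝ≥0∞) {P Q : Measure Z} (π : Measure (Z × Z))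
    (h₁ : π.map Prod.fst = P) (h₂ : π.map Prod.snd = Q) :
    wasserstein c P Q ≤ ∫⁻ z, c z.1 z.2 ∂π :=
  iInf_le_of_le π (iInf_le_of_le h₁ (iInf_le _ h₂))

lemma exists_coupling_of_wasserstein_lt {c : Z → Z → ℝ≥0∞} {P Q : Measure Z} {a : ℝ≥0∞}
    (h : wasserstein c P Q < a) :
    ∃ π : Measure (Z × Z), π.map Prod.fst = P ∧ π.map Prod.snd = Q ∧
      ∫⁻ z, c z.1 z.2 ∂π < a := by
  simpa only [wasserstein, iInf_lt_iff, exists_prop] using h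

lemma isProbabilityMeasure_of_map_fst {P : Measure Z} [IsProbabilityMeasure P]
    {π : Measure (Z × Z)} (h : π.map Prod.fst = P) : IsProbabilityMeasure π := by
  constructor
  have h' : (π.map Prod.fst) Set.univ = 1 := by rw [h]; exact measure_univ
  rwa [Measure.map_apply measurable_fst MeasurableSet.univ, Set.preimage_univ] at h'

lemma wasserstein_self {c : Z → Z → ℝ≥0∞} (hc : Measurable fun z : Z × Z => c z.1 z.2)
    (h0 : ∀ z, c z z = 0) (P : Measure Z) : wasserstein c P P = 0 := by
  have hm : Measurable fun z : Z => (z, z) := measurable_id.prodMk measurable_id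
  refine le_antisymm ((wasserstein_le_lintegral c (P.map fun z => (z, z)) ?_ ?_).trans ?_) zero_le
  · rw [Measure.map_map measurable_fst hm]; exact Measure.map_id
  · rw [Measure.map_map measurable_snd hm]; exact Measure.map_id
  · rw [lintegral_map hc hm]
    simp [h0]

lemma wasserstein_comm {c : Z → Z → ℝ≥0∞} (hc : Measurable fun z : Z × Z => c z.1 z.2)
    (hsymm : ∀ z z', c z z' = c z' z) (P Q : Measure Z) :
    wasserstein c P Q = wasserstein c Q P := by
  have key : ∀ P Q : Measure Z, wasserstein c P Q ≤ wasserstein c Q P := by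
    intro P Q
    refine le_iInf fun π => le_iInf fun h₁ => le_iInf fun h₂ => ?_
    refine (wasserstein_le_lintegral c (π.map Prod.swap) ?_ ?_).trans_eq ?_
    · rw [Measure.map_map measurable_fst measurable_swap, ← h₂]; rfl
    · rw [Measure.map_map measurable_snd measurable_swap, ← h₁]; rfl
    · rw [lintegral_map hc measurable_swap]
      exact lintegral_congr fun z => hsymm _ _
  exact le_antisymm (key P Q) (key Q P)

/-- Couplings with a common marginal can be glued together. -/
lemma exists_gluing [StandardBorelSpace Z] {π₁ π₂ : Measure (Z × Z)} [IsProbabilityMeasure π₁]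
    [IsProbabilityMeasure π₂] (h : π₁.map Prod.snd = π₂.map Prod.fst) :
    ∃ γ : Measure (Z × Z × Z), γ.map (fun x => (x.2.1, x.1)) = π₁ ∧
      γ.map (fun x => (x.1, x.2.2)) = π₂ := by
  have hne : Nonempty (Z × Z) := nonempty_of_isProbabilityMeasure π₁
  have : Nonempty Z := hne.map Prod.fst
  set ρ := π₁.map Prod.swap with hρ
  have : IsProbabilityMeasure ρ := Measure.isProbabilityMeasure_map measurable_swap.aemeasurable
  have hfst : ρ.fst = π₂.fst := by
    rw [Measure.fst, Measure.fst, hρ, Measure.map_map measurable_fst measurable_swap, ← h]; rfl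
  -- The common coordinate is drawn first, then the two outer ones conditionally independently given
  -- it.
  refine ⟨ρ.fst ⊗ₘ (ρ.condKernel ×ₖ π₂.condKernel), ?_, ?_⟩
  · have h1 : (ρ.fst ⊗ₘ (ρ.condKernel ×ₖ π₂.condKernel)).map (Prod.map id Prod.fst) = ρ := by
      rw [← Measure.compProd_map measurable_fst, ← ProbabilityTheory.Kernel.fst_eq,
        ProbabilityTheory.Kernel.fst_prod, ρ.disintegrate]
    have h2 : ρ.map Prod.swap = π₁ := by
      rw [hρ, Measure.map_map measurable_swap measurable_swap, Prod.swap_swap_eq, Measure.map_id]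
    conv_rhs => rw [← h2, ← h1, Measure.map_map measurable_swap (by fun_prop)]
    rfl
  · have h1 : (ρ.fst ⊗ₘ (ρ.condKernel ×ₖ π₂.condKernel)).map (Prod.map id Prod.snd) = π₂ := by
      rw [← Measure.compProd_map measurable_snd, ← ProbabilityTheory.Kernel.snd_eq,
        ProbabilityTheory.Kernel.snd_prod, hfst, π₂.disintegrate]
    exact h1

lemma wasserstein_triangle [StandardBorelSpace Z] {c : Z → Z → ℝ≥0∞}
    (hc : Measurable fun z : Z × Z => c z.1 z.2)
    (htri : ∀ x y z, c x z ≤ c x y + c y z) (P Q R : Measure Z) [IsProbabilityMeasure P]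
    [IsProbabilityMeasure Q] :
    wasserstein c P R ≤ wasserstein c P Q + wasserstein c Q R := by
  refine ENNReal.le_of_forall_pos_le_add fun ε hε hlt => ?_
  have hε' : (ε : ℝ≥0∞) / 2 ≠ 0 := by simpa using hε.ne'
  obtain ⟨hPQ, hQR⟩ := ENNReal.add_lt_top.1 hlt
  obtain ⟨π₁, h₁, h₁', hc₁⟩ := exists_coupling_of_wasserstein_lt
    (ENNReal.lt_add_right hPQ.ne hε')
  obtain ⟨π₂, h₂, h₂', hc₂⟩ := exists_coupling_of_wasserstein_lt
    (ENNReal.lt_add_right hQR.ne hε')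
  have := isProbabilityMeasure_of_map_fst h₁
  have := isProbabilityMeasure_of_map_fst h₂
  obtain ⟨γ, hγ₁, hγ₂⟩ := exists_gluing (h₁'.trans h₂.symm)
  have hm₁ : Measurable fun x : Z × Z × Z => (x.2.1, x.1) := by fun_prop
  have hm₂ : Measurable fun x : Z × Z × Z => (x.1, x.2.2) := by fun_prop
  refine (wasserstein_le_lintegral c (γ.map Prod.snd) ?_ ?_).trans ?_
  · rw [Measure.map_map measurable_fst measurable_snd, ← h₁, ← hγ₁,
      Measure.map_map measurable_fst hm₁]; rfl
  · rw [Measure.map_map measurable_snd measurable_snd, ← h₂', ← hγ₂,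
      Measure.map_map measurable_snd hm₂]; rfl
  · calc ∫⁻ z, c z.1 z.2 ∂(γ.map Prod.snd) = ∫⁻ x, c x.2.1 x.2.2 ∂γ :=
          lintegral_map hc measurable_snd
      _ ≤ ∫⁻ x, (c x.2.1 x.1 + c x.1 x.2.2) ∂γ := lintegral_mono fun x => htri _ _ _
      _ = ∫⁻ x, c x.2.1 x.1 ∂γ + ∫⁻ x, c x.1 x.2.2 ∂γ := lintegral_add_left (hc.comp hm₁) _
      _ = ∫⁻ z, c z.1 z.2 ∂π₁ + ∫⁻ z, c z.1 z.2 ∂π₂ := by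
          rw [← hγ₁, ← hγ₂, lintegral_map hc hm₁, lintegral_map hc hm₂]
      _ ≤ (wasserstein c P Q + ε / 2) + (wasserstein c Q R + ε / 2) := by gcongr
      _ = _ := by
          rw [add_add_add_comm, ENNReal.add_halves]

/-- If the Wasserstein distance is `0`, then integrable functions that are Lipschitz for the
ground distance have the same integrals. -/
lemma integral_eq_of_wasserstein_eq_zero {E : Type*} [NormedAddCommGroup E] [NormedSpace ℝ E]
    {c : Z → Z → ℝ≥0∞} {P Q : Measure Z}
    (h : wasserstein c P Q = 0) {H : Z → E} {K : ℝ≥0}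
    (hK : ∀ z z', edist (H z) (H z') ≤ K * c z z') (hP : Integrable H P) (hQ : Integrable H Q) :
    ∫ z, H z ∂P = ∫ z, H z ∂Q := by
  rw [← edist_eq_zero]
  refine le_antisymm (ENNReal.le_of_forall_pos_le_add fun ε hε _ => ?_) zero_le
  -- Dividing by `K + 1` instead of `K` covers the case `K = 0`.
  have hpos : (0 : ℝ≥0∞) < ε / (K + 1) := by
    refine ENNReal.div_pos (by simpa using hε.ne') (by finiteness)
  obtain ⟨π, h₁, h₂, hc⟩ := exists_coupling_of_wasserstein_lt (h.trans_lt hpos)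
  have i₁ : Integrable (fun z : Z × Z => H z.1) π := by
    rw [← h₁] at hP; exact hP.comp_measurable measurable_fst
  have i₂ : Integrable (fun z : Z × Z => H z.2) π := by
    rw [← h₂] at hQ; exact hQ.comp_measurable measurable_snd
  have e₁ : ∫ z, H z ∂P = ∫ z, H z.1 ∂π := by
    rw [← h₁] at hP ⊢
    exact integral_map measurable_fst.aemeasurable hP.aestronglyMeasurable
  have e₂ : ∫ z, H z ∂Q = ∫ z, H z.2 ∂π := by
    rw [← h₂] at hQ ⊢
    exact integral_map measurable_snd.aemeasurable hQ.aestronglyMeasurable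
  rw [e₁, e₂, zero_add, edist_eq_enorm_sub, ← integral_sub i₁ i₂]
  calc ‖∫ z, H z.1 - H z.2 ∂π‖ₑ ≤ ∫⁻ z, ‖H z.1 - H z.2‖ₑ ∂π := enorm_integral_le_lintegral_enorm _
    _ ≤ ∫⁻ z, K * c z.1 z.2 ∂π := lintegral_mono fun z => by
        rw [← edist_eq_enorm_sub]; exact hK _ _
    _ = K * ∫⁻ z, c z.1 z.2 ∂π := lintegral_const_mul' _ _ ENNReal.coe_ne_top
    _ ≤ (K + 1) * (ε / (K + 1)) := by gcongr; exact le_self_add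
    _ ≤ ε := ENNReal.mul_div_le

/-- The Wasserstein distance is lower semicontinuous if the marginals depend continuously on a
parameter and the ground distance is jointly continuous. -/
lemma lowerSemicontinuous_wasserstein {Z : Type} [MeasurableSpace Z] [TopologicalSpace Z]
    [PolishSpace Z] [BorelSpace Z]
    {Y : Type*} [TopologicalSpace Y] [TopologicalSpace.MetrizableSpace Y]
    [SecondCountableTopology Y]
    {c : Y → Z → Z → ℝ≥0∞} (hc : Continuous fun x : Y × Z × Z => c x.1 x.2.1 x.2.2)
    {P Q : Y → ProbabilityMeasure Z} (hP : Continuous P) (hQ : Continuous Q) :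
    LowerSemicontinuous fun y => wasserstein (c y) (P y : Measure Z) (Q y) := by
  borelize Y
  let _ := TopologicalSpace.upgradeIsCompletelyMetrizable Z
  rw [lowerSemicontinuous_iff_isClosed_preimage]
  intro a
  refine IsSeqClosed.isClosed fun y y₀ hy hlim => ?_
  simp only [Set.mem_preimage, Set.mem_Iic] at hy ⊢
  refine ENNReal.le_of_forall_pos_le_add fun ε hε hlt => ?_
  -- Almost optimal couplings along the sequence; a weak limit of them will couple the limiting
  -- marginals.
  choose π h₁ h₂ hπ using fun n => exists_coupling_of_wasserstein_lt
    ((hy n).trans_lt (ENNReal.lt_add_right hlt.ne (ENNReal.coe_ne_zero.2 hε.ne')))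
  have hprob : ∀ n, IsProbabilityMeasure (π n) := fun n => isProbabilityMeasure_of_map_fst (h₁ n)
  set p : ℕ → ProbabilityMeasure (Z × Z) := fun n => ⟨π n, hprob n⟩
  -- A convergent sequence of measures together with its limit is compact, hence tight. Tight
  -- marginals make the couplings tight.
  have htight : ∀ R : Y → ProbabilityMeasure Z, Continuous R →
      IsTightMeasureSet {((μ : ProbabilityMeasure Z) : Measure Z) | μ ∈ Set.range (R ∘ y)} := by
    intro R hR
    have hcomp := ((hR.tendsto y₀).comp hlim).isCompact_insert_range
    refine isTightMeasureSet_of_isCompact_closure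
      (hcomp.of_isClosed_subset isClosed_closure ?_)
    exact closure_minimal (Set.subset_insert _ _) hcomp.isClosed
  have hcompact : IsCompact (closure (Set.range p)) := by
    refine isCompact_closure_of_isTightMeasureSet (IsTightMeasureSet.prodMk ?_ ?_)
    · refine (htight P hP).subset ?_
      rintro _ ⟨_, ⟨_, ⟨n, rfl⟩, rfl⟩, rfl⟩
      exact ⟨P (y n), ⟨n, rfl⟩, (h₁ n).symm⟩
    · refine (htight Q hQ).subset ?_
      rintro _ ⟨_, ⟨_, ⟨n, rfl⟩, rfl⟩, rfl⟩
      exact ⟨Q (y n), ⟨n, rfl⟩, (h₂ n).symm⟩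
  -- An ultrafilter finer than `atTop` replaces the passage to a convergent subsequence.
  set U : Ultrafilter ℕ := Ultrafilter.of atTop
  have hUle : (U : Filter ℕ) ≤ atTop := Ultrafilter.of_le _
  obtain ⟨π₀, -, hπ₀⟩ := hcompact.ultrafilter_le_nhds' (U.map p)
    (Ultrafilter.mem_map.2 (Filter.Eventually.of_forall fun n => subset_closure ⟨n, rfl⟩))
  have hpU : Tendsto p U (𝓝 π₀) := hπ₀
  have hyU : Tendsto y U (𝓝 y₀) := hlim.mono_left hUle
  have hm₁ : (π₀ : Measure (Z × Z)).map Prod.fst = P y₀ := by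
    have l := ProbabilityMeasure.tendsto_map_of_tendsto_of_continuous _ _ hpU continuous_fst
    have l' := (hP.tendsto y₀).comp hyU
    have e : (fun n => (p n).map continuous_fst.measurable.aemeasurable) = P ∘ y :=
      funext fun n => Subtype.ext (h₁ n)
    rw [e] at l
    exact congrArg ProbabilityMeasure.toMeasure (tendsto_nhds_unique l l')
  have hm₂ : (π₀ : Measure (Z × Z)).map Prod.snd = Q y₀ := by
    have l := ProbabilityMeasure.tendsto_map_of_tendsto_of_continuous _ _ hpU continuous_snd
    have l' := (hQ.tendsto y₀).comp hyU
    have e : (fun n => (p n).map continuous_snd.measurable.aemeasurable) = Q ∘ y :=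
      funext fun n => Subtype.ext (h₂ n)
    rw [e] at l
    exact congrArg ProbabilityMeasure.toMeasure (tendsto_nhds_unique l l')
  refine (wasserstein_le_lintegral _ _ hm₁ hm₂).trans ?_
  -- The cost varies with `n`. Tensoring the coupling with the Dirac measure at `y n` turns it into
  -- one fixed continuous function on `Y × Z × Z`.
  have hdirac : ∀ (y : Y) (q : ProbabilityMeasure (Z × Z)) (f : Y × Z × Z → ℝ≥0∞),
      Measurable f → ∫⁻ x, f x ∂(((diracProba y).prod q : ProbabilityMeasure (Y × Z × Z)) :
        Measure (Y × Z × Z)) = ∫⁻ z, f (y, z) ∂(q : Measure (Z × Z)) := by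
    intro y q f hf
    rw [ProbabilityMeasure.toMeasure_prod, lintegral_prod _ hf.aemeasurable]
    exact lintegral_dirac' y hf.lintegral_prod_right'
  have hprod : Tendsto (fun n => (diracProba (y n)).prod (p n)) U
      (𝓝 ((diracProba y₀).prod π₀)) :=
    (ProbabilityMeasure.continuous_prod.tendsto (diracProba y₀, π₀)).comp
      (((continuous_diracProba.tendsto y₀).comp hyU).prodMk_nhds hpU)
  -- Weak convergence only sees bounded functions, so the cost is truncated at `M`; monotone
  -- convergence removes the truncation below.
  have htrunc : ∀ M : ℕ, ∫⁻ z, min (c y₀ z.1 z.2) M ∂(π₀ : Measure (Z × Z)) ≤ a + ε := by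
    intro M
    have hfin : ∀ x : Y × Z × Z, min (c x.1 x.2.1 x.2.2) M ≠ ∞ := fun x =>
      ((min_le_right _ _).trans_lt (ENNReal.natCast_lt_top M)).ne
    have hcont : Continuous fun x : Y × Z × Z => min (c x.1 x.2.1 x.2.2) (M : ℝ≥0∞) :=
      hc.min continuous_const
    let f : BoundedContinuousFunction (Y × Z × Z) ℝ≥0 :=
      BoundedContinuousFunction.mkOfBound
        ⟨fun x => (min (c x.1 x.2.1 x.2.2) M).toNNReal, by
          rw [continuous_iff_continuousAt]
          exact fun x => (ENNReal.tendsto_toNNReal (hfin x)).comp (hcont.tendsto x)⟩ M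
        (fun x x' => by
          have hb : ∀ x : Y × Z × Z, (min (c x.1 x.2.1 x.2.2) (M : ℝ≥0∞)).toNNReal ≤ M :=
            fun x => ENNReal.toNNReal_mono (ENNReal.natCast_ne_top M) (min_le_right _ _)
          rw [NNReal.dist_eq, abs_le]
          have h1 := NNReal.coe_le_coe.2 (hb x)
          have h2 := NNReal.coe_le_coe.2 (hb x')
          simp only [NNReal.coe_natCast] at h1 h2
          simp only [ContinuousMap.coe_mk]
          constructor <;> linarith [NNReal.coe_nonneg (min (c x.1 x.2.1 x.2.2) M).toNNReal,
            NNReal.coe_nonneg (min (c x'.1 x'.2.1 x'.2.2) M).toNNReal])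
    have hf : ∀ x, (f x : ℝ≥0∞) = min (c x.1 x.2.1 x.2.2) M := fun x =>
      ENNReal.coe_toNNReal (hfin x)
    have l := ProbabilityMeasure.tendsto_iff_forall_lintegral_tendsto.1 hprod f
    simp only [hf] at l
    rw [hdirac _ _ _ hcont.measurable] at l
    refine le_of_tendsto l (Filter.Eventually.of_forall fun n => ?_)
    rw [hdirac _ _ _ hcont.measurable]
    exact (lintegral_mono fun z => min_le_left _ _).trans (hπ n).le
  have hmono : ∫⁻ z, c y₀ z.1 z.2 ∂(π₀ : Measure (Z × Z)) =
      ⨆ M : ℕ, ∫⁻ z, min (c y₀ z.1 z.2) M ∂(π₀ : Measure (Z × Z)) := by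
    have hc₀ : Measurable fun z : Z × Z => c y₀ z.1 z.2 :=
      (hc.comp (continuous_const.prodMk continuous_id)).measurable
    rw [← lintegral_iSup (fun M => hc₀.min measurable_const)]
    · refine lintegral_congr fun z => ?_
      rw [← inf_iSup_eq, ENNReal.iSup_natCast]
      simp
    · intro M M' hM z
      have : (M : ℝ≥0∞) ≤ M' := by exact_mod_cast hM
      exact min_le_min le_rfl this
  rw [hmono]
  exact iSup_le htrunc

end Wasserstein

/-! ### The Radon transform -/

lemma SplittingMap.continuous_coord (α : SplittingMap d k) (i : Fin k) :
    Continuous fun x : Space d × LineSystem d k => (α x).1 i :=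
  (continuous_apply i).comp (continuous_subtype_val.comp α.continuous)

lemma SplittingMap.coord_nonneg (α : SplittingMap d k) (x : Space d × LineSystem d k)
    (i : Fin k) : 0 ≤ (α x).1 i := (α x).2.1 i

lemma SplittingMap.sum_coord (α : SplittingMap d k) (x : Space d × LineSystem d k) :
    ∑ i, (α x).1 i = 1 := (α x).2.2

lemma SplittingMap.coord_le_one (α : SplittingMap d k) (x : Space d × LineSystem d k)
    (i : Fin k) : (α x).1 i ≤ 1 :=
  (Finset.single_le_sum (f := (α x).1) (fun j _ => α.coord_nonneg x j)
    (Finset.mem_univ i)).trans_eq (α.sum_coord x)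

/-- The projection of a point to line `i`, as a point of the ground set. -/
def lineProj (L : LineSystem d k) (i : Fin k) (y : Space d) : Ground k :=
  (i, inner ℝ (y - (L i).1) ((L i).2 : Space d))

lemma continuous_lineProj (i : Fin k) :
    Continuous fun x : Space d × LineSystem d k => lineProj x.2 i x.1 := by
  unfold lineProj
  fun_prop

lemma continuous_lineProj_right (L : LineSystem d k) (i : Fin k) : Continuous (lineProj L i) :=
  (continuous_lineProj i).comp (continuous_id.prodMk continuous_const)

lemma SplittingMap.continuous_coord_left (α : SplittingMap d k) (L : LineSystem d k)
    (i : Fin k) : Continuous fun y => (α (y, L)).1 i :=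
  (α.continuous_coord i).comp (continuous_id.prodMk continuous_const)

lemma lintegral_radon (α : SplittingMap d k) (L : LineSystem d k) (μ : Measure (Space d))
    {f : Ground k → ℝ≥0∞} (hf : Measurable f) :
    ∫⁻ z, f z ∂(radon α L μ) =
      ∑ i, ∫⁻ y, ENNReal.ofReal ((α (y, L)).1 i) * f (lineProj L i y) ∂μ := by
  rw [radon, lintegral_finsetSum_measure]
  refine Finset.sum_congr rfl fun i _ => ?_
  have hm : Measurable (lineProj L i) := (continuous_lineProj_right L i).measurable
  rw [show (fun y => (i, inner ℝ (y - (L i).1) ((L i).2 : Space d))) = lineProj L i from rfl,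
    lintegral_map hf hm, lintegral_withDensity_eq_lintegral_mul]
  · rfl
  · exact (α.continuous_coord_left L i).measurable.ennreal_ofReal
  · exact hf.comp hm

instance isProbabilityMeasure_radon (α : SplittingMap d k) (L : LineSystem d k)
    (μ : Measure (Space d)) [IsProbabilityMeasure μ] : IsProbabilityMeasure (radon α L μ) := by
  constructor
  have h := lintegral_radon α L μ (measurable_const (a := (1 : ℝ≥0∞)))
  simp only [lintegral_const, one_mul, mul_one] at h
  rw [h, ← lintegral_finsetSum _
    fun i _ => (α.continuous_coord_left L i).measurable.ennreal_ofReal]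
  simp only [← ENNReal.ofReal_sum_of_nonneg fun i _ => α.coord_nonneg _ i, α.sum_coord]
  simp

lemma integral_radon {E : Type*} [NormedAddCommGroup E] [NormedSpace ℝ E]
    (α : SplittingMap d k) (L : LineSystem d k) (μ : Measure (Space d))
    [IsProbabilityMeasure μ] {f : Ground k → E} (hf : Continuous f) {C : ℝ}
    (hC : ∀ z, ‖f z‖ ≤ C) [SecondCountableTopology E] :
    ∫ z, f z ∂(radon α L μ) = ∑ i, ∫ y, (α (y, L)).1 i • f (lineProj L i y) ∂μ := by
  borelize E
  have hint : Integrable f (radon α L μ) :=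
    Integrable.of_bound hf.aestronglyMeasurable C (Eventually.of_forall hC)
  rw [radon] at hint ⊢
  rw [integral_finsetSum_measure fun i hi =>
    (integrable_finsetSum_measure.1 hint i hi)]
  refine Finset.sum_congr rfl fun i _ => ?_
  have hm : Measurable (lineProj L i) := (continuous_lineProj_right L i).measurable
  rw [show (fun y => (i, inner ℝ (y - (L i).1) ((L i).2 : Space d))) = lineProj L i from rfl,
    integral_map hm.aemeasurable hf.aestronglyMeasurable]
  rw [integral_withDensity_eq_integral_toReal_smul
    (α.continuous_coord_left L i).measurable.ennreal_ofReal (by simp)]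
  simp only [ENNReal.toReal_ofReal (α.coord_nonneg _ i)]

/-- The Radon transform of a probability measure, as a probability measure. -/
def radonProb (α : SplittingMap d k) (μ : ProbabilityMeasure (Space d)) (L : LineSystem d k) :
    ProbabilityMeasure (Ground k) :=
  ⟨radon α L (μ : Measure (Space d)), inferInstance⟩

/-- Against a bounded continuous `f`, the integrands over `ℝ^d` are continuous in `L` and bounded by
`‖f‖`, so dominated convergence applies. -/
lemma continuous_radonProb (α : SplittingMap d k) (μ : ProbabilityMeasure (Space d)) :
    Continuous (radonProb α μ) := by
  rw [ProbabilityMeasure.continuous_iff_forall_continuous_integral]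
  intro f
  have h : ∀ L, ∫ z, f z ∂(radonProb α μ L : Measure (Ground k)) =
      ∑ i, ∫ y, (α (y, L)).1 i • f (lineProj L i y) ∂(μ : Measure (Space d)) := fun L =>
    integral_radon α L μ f.continuous f.norm_coe_le_norm
  simp only [h]
  refine continuous_finsetSum _ fun i _ => ?_
  have hcont : Continuous fun x : Space d × LineSystem d k =>
      (α x).1 i • f (lineProj x.2 i x.1) :=
    (α.continuous_coord i).smul (f.continuous.comp (continuous_lineProj i))
  refine continuous_of_dominated (bound := fun _ => ‖f‖) (fun L => ?_) (fun L => ?_)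
    (integrable_const _) (Eventually.of_forall fun y => ?_)
  · exact (hcont.comp (continuous_id.prodMk continuous_const)).aestronglyMeasurable
  · refine Eventually.of_forall fun y => ?_
    rw [norm_smul, Real.norm_of_nonneg (α.coord_nonneg _ i)]
    exact (mul_le_of_le_one_left (norm_nonneg _) (α.coord_le_one _ i)).trans
      (f.norm_coe_le_norm _)
  · exact hcont.comp (continuous_const.prodMk continuous_id)

lemma lineProj_act (g : EuclideanGroup d) (L : LineSystem d k) (i : Fin k) (y : Space d) :
    lineProj (actLines g L) i (g y) = lineProj L i y := by
  have h : g y - g (L i).1 = g.linearIsometryEquiv (y - (L i).1) := by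
    have := g.map_vsub y (L i).1
    simpa only [vsub_eq_sub] using this.symm
  simp only [lineProj, actLines, actLine, h, LinearIsometryEquiv.inner_map_map]

lemma radon_act {α : SplittingMap d k} (hα : α.IsInvariant) (g : EuclideanGroup d)
    (L : LineSystem d k) (μ : Measure (Space d)) :
    radon α (actLines g L) (μ.map g) = radon α L μ := by
  refine Measure.ext_of_lintegral _ fun f hf => ?_
  rw [lintegral_radon α _ _ hf, lintegral_radon α _ _ hf]
  refine Finset.sum_congr rfl fun i _ => ?_
  rw [lintegral_map _ g.continuous.measurable]
  · simp only [hα g _ L, lineProj_act]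
  · exact (α.continuous_coord_left _ i).measurable.ennreal_ofReal.mul
      (hf.comp (continuous_lineProj_right _ i).measurable)

lemma TreeSystem.routeLength_act (g : EuclideanGroup d) (L : TreeSystem d G) {i j : Fin k}
    (w : G.Walk i j) (t t' : ℝ) : (L.act g).routeLength w t t' = L.routeLength w t t' := by
  induction w generalizing t with
  | nil => rfl
  | cons h w ih => rw [routeLength_cons, routeLength_cons, ih]; rfl

lemma TreeSystem.treeDist_act (g : EuclideanGroup d) (L : TreeSystem d G) :
    (L.act g).treeDist = L.treeDist := by
  funext p q
  simp only [treeDist, routeLength_act]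

lemma wasserstein_act {α : SplittingMap d k} (hα : α.IsInvariant) (g : EuclideanGroup d)
    (L : TreeSystem d G) (μ ν : ProbabilityMeasure (Space d)) :
    wasserstein (L.act g).treeDist (radon α (L.act g).lines (push g μ : Measure (Space d)))
      (radon α (L.act g).lines (push g ν : Measure (Space d))) =
    wasserstein L.treeDist (radon α L.lines (μ : Measure (Space d)))
      (radon α L.lines (ν : Measure (Space d))) := by
  rw [L.treeDist_act, show (L.act g).lines = actLines g L.lines from rfl, push, push,
    ProbabilityMeasure.toMeasure_map, ProbabilityMeasure.toMeasure_map, radon_act hα,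
    radon_act hα]

lemma lowerSemicontinuous_wasserstein_radon (hG : G.IsTree) (α : SplittingMap d k)
    (μ ν : ProbabilityMeasure (Space d)) :
    LowerSemicontinuous fun L : TreeSystem d G =>
      wasserstein L.treeDist (radon α L.lines (μ : Measure (Space d)))
        (radon α L.lines (ν : Measure (Space d))) :=
  lowerSemicontinuous_wasserstein (Y := TreeSystem d G) (Z := Ground k)
    (c := fun L => L.treeDist) (P := fun L => radonProb α μ L.lines)
    (Q := fun L => radonProb α ν L.lines) (TreeSystem.continuous_treeDist hG)
    ((continuous_radonProb α μ).comp TreeSystem.continuous_lines)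
    ((continuous_radonProb α ν).comp TreeSystem.continuous_lines)

/-! ### Averages of translates of a nonnegative function

A nonnegative bounded continuous function `F ≠ 0` is averaged with the slowly varying weights
`(R + ‖a‖)⁻⁽ⁿ⁺¹⁾`. Normalized at almost maximal points, the averages converge to `1` as `R → ∞`,
boundedly. Hence a measure which is orthogonal to all translates of `F` has total mass `0`. -/

section Averages

variable {E : Type*} [NormedAddCommGroup E] [NormedSpace ℝ E]

/-- The weight `(R + ‖a‖)⁻⁽ⁿ⁺¹⁾`, where `n` is the dimension. -/
def weight (R : ℝ) (a : E) : ℝ := ((R + ‖a‖) ^ (Module.finrank ℝ E + 1))⁻¹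

lemma weight_pos {R : ℝ} (hR : 0 < R) (a : E) : 0 < weight R a := by
  unfold weight
  positivity

lemma continuous_weight {R : ℝ} (hR : 0 < R) : Continuous (weight R : E → ℝ) := by
  unfold weight
  refine Continuous.inv₀ (by fun_prop) fun a => ?_
  positivity

/-- Slow variation: for fixed `y` the factor tends to `1` as `R → ∞`, uniformly in `a`. -/
lemma weight_le_mul_weight_add {R : ℝ} (hR : 0 < R) (a y : E) :
    weight R a ≤ (1 + ‖y‖ / R) ^ (Module.finrank ℝ E + 1) * weight R (a + y) := by
  unfold weight
  rw [← div_eq_mul_inv, inv_eq_one_div, div_le_div_iff₀ (by positivity) (by positivity), one_mul,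
    ← mul_pow]
  refine pow_le_pow_left₀ (by positivity) ?_ _
  have h : (1 + ‖y‖ / R) * (R + ‖a‖) = R + ‖a‖ + ‖y‖ + ‖y‖ * ‖a‖ / R := by
    field_simp
    ring
  have : 0 ≤ ‖y‖ * ‖a‖ / R := by positivity
  rw [h]
  linarith [norm_add_le a y]

variable [FiniteDimensional ℝ E] [MeasurableSpace E] [BorelSpace E]

/-- The exponent exceeds the dimension by one, which is enough for integrability at infinity. -/
lemma integrable_weight {R : ℝ} (hR : 1 ≤ R) :
    Integrable (weight R : E → ℝ) Measure.addHaar := by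
  have h := integrable_one_add_norm (E := E) (μ := Measure.addHaar)
    (r := (Module.finrank ℝ E + 1 : ℕ)) (by push_cast; linarith)
  refine h.mono' (continuous_weight (by linarith)).aestronglyMeasurable
    (Eventually.of_forall fun a => ?_)
  rw [Real.norm_of_nonneg (weight_pos (by linarith) a).le, Real.rpow_neg (by positivity),
    Real.rpow_natCast]
  unfold weight
  gcongr

/-- The weighted average of the translates of `F`. -/
def translateAvg (F : E → ℝ) (R : ℝ) (y : E) : ℝ :=
  ∫ a, weight R a * F (y + a) ∂Measure.addHaar

lemma integrable_weight_mul {F : E → ℝ} {C : ℝ} (hF : Continuous F)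
    (hF0 : ∀ y, 0 ≤ F y) (hFC : ∀ y, F y ≤ C)
    {R : ℝ} (hR : 1 ≤ R) (y z : E) :
    Integrable (fun a => weight R (a + z) * F (y + a)) Measure.addHaar :=
  ((integrable_weight hR).comp_add_right z).mul_bdd (c := C)
    (by fun_prop) (Eventually.of_forall fun a => by
      rw [Real.norm_of_nonneg (hF0 _)]; exact hFC _)

lemma translateAvg_le {F : E → ℝ} {C : ℝ} (hF : Continuous F)
    (hF0 : ∀ y, 0 ≤ F y) (hFC : ∀ y, F y ≤ C)
    {R : ℝ} (hR : 1 ≤ R) (y : E) :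
    translateAvg F R y ≤ (∫ a : E, weight R a ∂Measure.addHaar) * C := by
  rw [translateAvg, ← integral_mul_const]
  have h := integrable_weight_mul hF hF0 hFC hR y 0
  simp only [add_zero] at h
  refine integral_mono h ((integrable_weight hR).mul_const C) fun a => ?_
  exact mul_le_mul_of_nonneg_left (hFC _) (weight_pos (by linarith) a).le

lemma translateAvg_le_mul {F : E → ℝ} {C : ℝ} (hF : Continuous F)
    (hF0 : ∀ y, 0 ≤ F y) (hFC : ∀ y, F y ≤ C)
    {R : ℝ} (hR : 1 ≤ R) (y z : E) :
    translateAvg F R y ≤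
      (1 + ‖z‖ / R) ^ (Module.finrank ℝ E + 1) * translateAvg F R (y + z) := by
  -- Translation invariance of Haar measure moves the shift `z` from `F` to the weight.
  have e : translateAvg F R (y + z) = ∫ a, weight R (a + -z) * F (y + a) ∂Measure.addHaar := by
    rw [translateAvg, ← integral_add_right_eq_self _ (-z)]
    refine integral_congr_ae (Eventually.of_forall fun a => ?_)
    simp only
    congr 2
    abel
  rw [e, ← integral_const_mul, translateAvg]
  have h := integrable_weight_mul hF hF0 hFC hR y 0
  simp only [add_zero] at h
  refine integral_mono h ((integrable_weight_mul hF hF0 hFC hR y (-z)).const_mul _) fun a => ?_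
  have := weight_le_mul_weight_add (by linarith : 0 < R) a (-z)
  rw [norm_neg] at this
  calc weight R a * F (y + a)
      ≤ ((1 + ‖z‖ / R) ^ (Module.finrank ℝ E + 1) * weight R (a + -z)) * F (y + a) :=
        mul_le_mul_of_nonneg_right this (hF0 _)
    _ = _ := mul_assoc _ _ _

lemma continuous_translateAvg {F : E → ℝ} {C : ℝ} (hF : Continuous F)
    (hF0 : ∀ y, 0 ≤ F y) (hFC : ∀ y, F y ≤ C)
    {R : ℝ} (hR : 1 ≤ R) : Continuous (translateAvg F R) := by
  have hw := continuous_weight (E := E) (by linarith : 0 < R)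
  refine continuous_of_dominated (bound := fun a => weight R a * C) (fun y => ?_) (fun y => ?_)
    ((integrable_weight hR).mul_const C) (Eventually.of_forall fun a => by fun_prop)
  · exact (by fun_prop : Continuous fun a => weight R a * F (y + a)).aestronglyMeasurable
  · refine Eventually.of_forall fun a => ?_
    have := (weight_pos (by linarith : 0 < R) a).le
    rw [Real.norm_of_nonneg (mul_nonneg this (hF0 _))]
    exact mul_le_mul_of_nonneg_left (hFC _) this

/-- The supremum of the averages is finite and positive but need not be attained; `b` is a point
where more than half of it is reached. -/
lemma exists_translateAvg_le_two_mul {F : E → ℝ} {C : ℝ} (hF : Continuous F)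
    (hF0 : ∀ y, 0 ≤ F y) (hFC : ∀ y, F y ≤ C)
    {R : ℝ} (hR : 1 ≤ R) {z : E} (hz : F z ≠ 0) :
    ∃ b, 0 < translateAvg F R b ∧ ∀ y, translateAvg F R y ≤ 2 * translateAvg F R b := by
  have hpos : 0 < translateAvg F R z := by
    have hw := continuous_weight (E := E) (by linarith : 0 < R)
    have h := integrable_weight_mul hF hF0 hFC hR z 0
    simp only [add_zero] at h
    refine integral_pos_of_integrable_nonneg_nonzero (x := 0)
      (by fun_prop) h (fun a => mul_nonneg (weight_pos (by linarith) a).le (hF0 _)) ?_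
    simpa using ⟨(weight_pos (by linarith : 0 < R) (0 : E)).ne', hz⟩
  have hbdd : BddAbove (Set.range (translateAvg F R)) :=
    ⟨_, by rintro _ ⟨y, rfl⟩; exact translateAvg_le hF hF0 hFC hR y⟩
  have hsup : 0 < ⨆ y, translateAvg F R y := hpos.trans_le (le_ciSup hbdd z)
  obtain ⟨b, hb⟩ := exists_lt_of_lt_ciSup (half_lt_self hsup)
  refine ⟨b, (half_pos hsup).trans hb, fun y => ?_⟩
  linarith [le_ciSup hbdd y]

lemma integral_translateAvg_smul {F : E → ℝ} {C : ℝ} (hF : Continuous F)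
    (hF0 : ∀ y, 0 ≤ F y) (hFC : ∀ y, F y ≤ C)
    {R : ℝ} (hR : 1 ≤ R) (μ : Measure E) [IsProbabilityMeasure μ]
    {φ : E → ℂ} (hφ : Continuous φ) {D : ℝ} (hφD : ∀ y, ‖φ y‖ ≤ D) (b : E) :
    ∫ y, translateAvg F R (y + b) • φ y ∂μ =
      ∫ a, weight R a • ∫ y, F (y + (b + a)) • φ y ∂μ ∂Measure.addHaar := by
  have hw := continuous_weight (E := E) (by linarith : 0 < R)
  have hC : 0 ≤ C := (hF0 0).trans (hFC 0)
  have hint : Integrable (fun p : E × E => weight R p.2 • (F (p.1 + (b + p.2)) • φ p.1))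
      (μ.prod Measure.addHaar) := by
    refine (((integrable_weight hR).comp_snd μ).mul_const (C * D)).mono'
      (by fun_prop : Continuous _).aestronglyMeasurable (Eventually.of_forall fun p => ?_)
    rw [norm_smul, norm_smul, Real.norm_of_nonneg (hF0 _),
      Real.norm_of_nonneg (weight_pos (by linarith : 0 < R) p.2).le]
    exact mul_le_mul_of_nonneg_left (mul_le_mul (hFC _) (hφD _) (norm_nonneg _) hC)
      (weight_pos (by linarith : 0 < R) p.2).le
  calc ∫ y, translateAvg F R (y + b) • φ y ∂μ
      = ∫ y, ∫ a, weight R a • (F (y + (b + a)) • φ y) ∂Measure.addHaar ∂μ := by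
        refine integral_congr_ae (Eventually.of_forall fun y => ?_)
        simp only [translateAvg, ← integral_smul_const, smul_smul, add_assoc]
    _ = ∫ a, ∫ y, weight R a • (F (y + (b + a)) • φ y) ∂μ ∂Measure.addHaar :=
        integral_integral_swap hint
    _ = _ := by simp only [integral_smul]

/-- Slow variation, applied in both directions, squeezes the normalized average between `(1 + ‖y‖ /
R n) ^ (-N)` and `(1 + ‖y‖ / R n) ^ N`, where `N` is the dimension plus one. The choice of `b n`
bounds it by `2`, so dominated convergence applies. -/
lemma tendsto_integral_translateAvg {F : E → ℝ} {C : ℝ} (hF : Continuous F)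
    (hF0 : ∀ y, 0 ≤ F y) (hFC : ∀ y, F y ≤ C)
    {R : ℕ → ℝ} (hR : ∀ n, 1 ≤ R n) (hR' : Tendsto R atTop atTop)
    {b : ℕ → E} (hb : ∀ n, 0 < translateAvg F (R n) (b n))
    (hb' : ∀ n y, translateAvg F (R n) y ≤ 2 * translateAvg F (R n) (b n))
    (μ : Measure E) [IsProbabilityMeasure μ]
    {φ : E → ℂ} (hφ : Continuous φ) {D : ℝ} (hφD : ∀ y, ‖φ y‖ ≤ D) :
    Tendsto (fun n => ∫ y, ((translateAvg F (R n) (b n))⁻¹ * translateAvg F (R n) (y + b n)) • φ y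
      ∂μ) atTop (𝓝 (∫ y, φ y ∂μ)) := by
  have hcont := fun n => continuous_translateAvg hF hF0 hFC (hR n)
  have hnn : ∀ n y, 0 ≤ translateAvg F (R n) y := fun n y => integral_nonneg fun a =>
    mul_nonneg (weight_pos (by linarith [hR n]) a).le (hF0 _)
  refine tendsto_integral_of_dominated_convergence (fun _ => 2 * D) (fun n => ?_)
    (integrable_const _) (fun n => Eventually.of_forall fun y => ?_)
    (Eventually.of_forall fun y => ?_)
  · have := hcont n
    exact (by fun_prop : Continuous _).aestronglyMeasurable
  · rw [norm_smul, Real.norm_of_nonneg (mul_nonneg (inv_nonneg.2 (hb n).le) (hnn n _))]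
    refine mul_le_mul ?_ (hφD y) (norm_nonneg _) zero_le_two
    rw [inv_mul_le_iff₀ (hb n), mul_comm]
    exact hb' n _
  · set N := Module.finrank ℝ E + 1
    have hq : Tendsto (fun n => (1 + ‖y‖ / R n) ^ N) atTop (𝓝 1) := by
      have := ((tendsto_const_nhds (x := ‖y‖)).div_atTop hR').const_add 1
      simpa using this.pow N
    have hlim : Tendsto (fun n => (translateAvg F (R n) (b n))⁻¹ * translateAvg F (R n) (y + b n))
        atTop (𝓝 1) := by
      refine tendsto_of_tendsto_of_tendsto_of_le_of_le (by simpa using hq.inv₀ one_ne_zero) hq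
        (fun n => ?_) (fun n => ?_)
      · have h := translateAvg_le_mul hF hF0 hFC (hR n) (b n) y
        have hp : 0 < (1 + ‖y‖ / R n) ^ N := by have := hR n; positivity
        rw [le_inv_mul_iff₀ (hb n), ← div_eq_mul_inv, div_le_iff₀ hp, mul_comm, add_comm y]
        exact h
      · have h := translateAvg_le_mul hF hF0 hFC (hR n) (y + b n) (-y)
        rw [norm_neg, add_neg_cancel_comm] at h
        rw [inv_mul_le_iff₀ (hb n), mul_comm]
        exact h
    simpa using hlim.smul_const (φ y)

lemma integral_eq_of_forall_translate {F : E → ℝ} {C : ℝ} (hF : Continuous F)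
    (hF0 : ∀ y, 0 ≤ F y) (hFC : ∀ y, F y ≤ C)
    {z : E} (hz : F z ≠ 0) {μ ν : Measure E}
    [IsProbabilityMeasure μ] [IsProbabilityMeasure ν] {φ : E → ℂ} (hφ : Continuous φ) {D : ℝ}
    (hφD : ∀ y, ‖φ y‖ ≤ D)
    (h : ∀ a, ∫ y, F (y + a) • φ y ∂μ = ∫ y, F (y + a) • φ y ∂ν) :
    ∫ y, φ y ∂μ = ∫ y, φ y ∂ν := by
  have hR : ∀ n : ℕ, (1 : ℝ) ≤ n + 1 := fun n => by
    have : (0 : ℝ) ≤ n := n.cast_nonneg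
    linarith
  have hR' : Tendsto (fun n : ℕ => (n : ℝ) + 1) atTop atTop :=
    tendsto_atTop_add_const_right _ _ tendsto_natCast_atTop_atTop
  choose b hb hb' using fun n => exists_translateAvg_le_two_mul hF hF0 hFC (hR n) hz
  have hμ := tendsto_integral_translateAvg hF hF0 hFC hR hR' hb hb' μ hφ hφD
  have hν := tendsto_integral_translateAvg hF hF0 hFC hR hR' hb hb' ν hφ hφD
  refine tendsto_nhds_unique hμ (hν.congr fun n => ?_)
  simp only [mul_smul, integral_smul]
  rw [integral_translateAvg_smul hF hF0 hFC (hR n) μ hφ hφD,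
    integral_translateAvg_smul hF hF0 hFC (hR n) ν hφ hφD]
  simp only [h]

end Averages

/-! ### Vanishing of the distance -/

lemma measurable_wasserstein_radon (hG : G.IsTree) (α : SplittingMap d k)
    (μ ν : ProbabilityMeasure (Space d)) :
    Measurable fun L : TreeSystem d G =>
      wasserstein L.treeDist (radon α L.lines (μ : Measure (Space d)))
        (radon α L.lines (ν : Measure (Space d))) :=
  (lowerSemicontinuous_wasserstein_radon hG α μ ν).measurable

/-- If the distance is `0`, then the Radon transforms have Wasserstein distance `0` on all tree
systems in the support. -/
lemma wasserstein_eq_zero_of_mem_support (hG : G.IsTree) (α : SplittingMap d k)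
    {σ : Measure (TreeSystem d G)} {μ ν : ProbabilityMeasure (Space d)}
    (h : dbTSW α σ μ ν = 0) {L : TreeSystem d G} (hL : L ∈ σ.support) :
    wasserstein L.treeDist (radon α L.lines (μ : Measure (Space d)))
      (radon α L.lines (ν : Measure (Space d))) = 0 := by
  have hae := (lintegral_eq_zero_iff (measurable_wasserstein_radon hG α μ ν)).1 h
  -- The set where the distance is at most `0` is closed and conull, so it contains the support.
  have hclosed := (lowerSemicontinuous_wasserstein_radon (d := d) hG α μ ν).isClosed_preimage 0
  have hmem := Measure.support_subset_of_isClosed hclosed (by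
    filter_upwards [hae] with L hL
    exact hL.le) hL
  exact le_antisymm hmem zero_le

/-- Equality of integrals of test functions on the lines which respect the gluing. -/
lemma sum_integral_eq_of_wasserstein_eq_zero (hG : G.IsTree) (α : SplittingMap d k)
    {L : TreeSystem d G} {μ ν : ProbabilityMeasure (Space d)}
    (h : wasserstein L.treeDist (radon α L.lines (μ : Measure (Space d)))
      (radon α L.lines (ν : Measure (Space d))) = 0)
    {H : Fin k → ℝ → ℂ} {K : ℝ≥0} (hH : ∀ i, LipschitzWith K (H i)) {C : ℝ}
    (hC : ∀ i t, ‖H i t‖ ≤ C)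
    (hglue : ∀ i j, G.Adj i j → H i (L.param i j) = H j (L.param j i)) :
    ∑ i, ∫ y, (α (y, L.lines)).1 i •
        H i (inner ℝ (y - (L.lines i).1) ((L.lines i).2 : Space d)) ∂(μ : Measure (Space d)) =
      ∑ i, ∫ y, (α (y, L.lines)).1 i •
        H i (inner ℝ (y - (L.lines i).1) ((L.lines i).2 : Space d)) ∂(ν : Measure (Space d)) := by
  set f : Ground k → ℂ := fun z => H z.1 z.2 with hf
  have hcont : Continuous f := continuous_prod_of_discrete_left.2 fun i => (hH i).continuous
  have hint : ∀ ρ : ProbabilityMeasure (Space d),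
      Integrable f (radon α L.lines (ρ : Measure (Space d))) := fun ρ =>
    Integrable.of_bound hcont.aestronglyMeasurable C (Eventually.of_forall fun z => hC _ _)
  have key := integral_eq_of_wasserstein_eq_zero h
    (L.edist_le_mul_treeDist hG hH hglue) (hint μ) (hint ν)
  have e : ∀ ρ : ProbabilityMeasure (Space d), ∫ z, f z ∂(radon α L.lines (ρ : Measure (Space d))) =
      ∑ i, ∫ y, (α (y, L.lines)).1 i • f (lineProj L.lines i y) ∂(ρ : Measure (Space d)) :=
    fun ρ => integral_radon α L.lines ρ hcont fun z => hC _ _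
  rw [← hf] at key
  exact (e μ).symm.trans (key.trans (e ν))

/-- The character `t ↦ exp (i r t)` of the real line. -/
def wave (r t : ℝ) : ℂ := Complex.exp (((r * t : ℝ) : ℂ) * Complex.I)

lemma norm_wave (r t : ℝ) : ‖wave r t‖ = 1 := Complex.norm_exp_ofReal_mul_I _

lemma wave_add (r s t : ℝ) : wave r (s + t) = wave r s * wave r t := by
  rw [wave, wave, wave, ← Complex.exp_add]
  congr 1
  push_cast
  ring

lemma norm_wave_sub_wave_le (r s t : ℝ) : ‖wave r s - wave r t‖ ≤ |r| * |s - t| := by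
  have h : wave r s - wave r t =
      wave r t * (Complex.exp (Complex.I * ((r * (s - t) : ℝ) : ℂ)) - 1) := by
    have : wave r s = wave r t * wave r (s - t) := by rw [← wave_add]; congr 1; ring
    rw [this, mul_comm Complex.I, ← wave, mul_sub, mul_one]
  rw [h, norm_mul, norm_wave, one_mul, ← abs_mul]
  exact Real.norm_exp_I_mul_ofReal_sub_one_le

lemma lipschitzWith_wave (r : ℝ) : LipschitzWith (Real.nnabs r) (wave r) :=
  LipschitzWith.of_dist_le_mul fun s t => by
    rw [dist_eq_norm, Real.dist_eq]
    exact norm_wave_sub_wave_le r s t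

/-- A Lipschitz function with values in `[0, 1]` times a character is Lipschitz. -/
lemma lipschitzWith_mul_wave {χ : ℝ → ℝ} (hχ : LipschitzWith 1 χ) (h0 : ∀ t, 0 ≤ χ t)
    (h1 : ∀ t, χ t ≤ 1) (r : ℝ) :
    LipschitzWith (1 + Real.nnabs r) fun t => (χ t : ℂ) * wave r t :=
  LipschitzWith.of_dist_le_mul fun s t => by
    have e : (χ s : ℂ) * wave r s - χ t * wave r t =
        ((χ s - χ t : ℝ) : ℂ) * wave r s + χ t * (wave r s - wave r t) := by
      push_cast
      ring
    have hd := hχ.dist_le_mul s t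
    rw [Real.dist_eq, Real.dist_eq, NNReal.coe_one, one_mul] at hd
    rw [dist_eq_norm, e, Real.dist_eq]
    refine (norm_add_le _ _).trans ?_
    rw [norm_mul, norm_mul, norm_wave, mul_one, Complex.norm_real, Complex.norm_real,
      Real.norm_of_nonneg (h0 t), Real.norm_eq_abs, NNReal.coe_add, add_mul, NNReal.coe_one,
      one_mul]
    exact add_le_add hd ((mul_le_of_le_one_left (norm_nonneg _) (h1 t)).trans
      (norm_wave_sub_wave_le r s t))

/-- A frequency `ξ ≠ 0` is `r = ‖ξ‖` times a unit vector. At `ξ = 0` both characteristic functions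
give the total mass; this case is separate because for `d = 0` there are no directions. -/
lemma eq_of_forall_integral_wave {μ ν : ProbabilityMeasure (Space d)}
    (h : ∀ (θ : Metric.sphere (0 : Space d) 1) (r : ℝ),
      ∫ y, wave r (inner ℝ y (θ : Space d)) ∂(μ : Measure (Space d)) =
        ∫ y, wave r (inner ℝ y (θ : Space d)) ∂(ν : Measure (Space d))) : μ = ν := by
  refine ProbabilityMeasure.toMeasure_injective (Measure.ext_of_charFun (funext fun ξ => ?_))
  rcases eq_or_ne ξ 0 with rfl | hξ
  · simp only [charFun_zero]
    exact congrArg _ ((probReal_univ (μ := (μ : Measure (Space d)))).trans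
      (probReal_univ (μ := (ν : Measure (Space d)))).symm)
  · have hn : ‖ξ‖ ≠ 0 := norm_ne_zero_iff.2 hξ
    have hs : ‖ξ‖⁻¹ • ξ ∈ Metric.sphere (0 : Space d) 1 := by
      rw [mem_sphere_zero_iff_norm, norm_smul, norm_inv, norm_norm, inv_mul_cancel₀ hn]
    have e : ∀ y : Space d, wave ‖ξ‖ (inner ℝ y (‖ξ‖⁻¹ • ξ)) =
        Complex.exp ((inner ℝ y ξ : ℝ) * Complex.I) := fun y => by
      rw [wave, inner_smul_right, mul_inv_cancel_left₀ hn]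
    have := h ⟨_, hs⟩ ‖ξ‖
    simp only [e] at this
    rw [charFun_apply, charFun_apply]
    exact this

/-- A system of lines with a common direction determines the projection to that direction. -/
lemma integral_wave_eq_of_common_direction (hG : G.IsTree) (α : SplittingMap d k)
    {L : TreeSystem d G} {θ : Metric.sphere (0 : Space d) 1} (hθ : ∀ i, (L.lines i).2 = θ)
    {μ ν : ProbabilityMeasure (Space d)}
    (h : wasserstein L.treeDist (radon α L.lines (μ : Measure (Space d)))
      (radon α L.lines (ν : Measure (Space d))) = 0) (r : ℝ) :
    ∫ y, wave r (inner ℝ y (θ : Space d)) ∂(μ : Measure (Space d)) =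
      ∫ y, wave r (inner ℝ y (θ : Space d)) ∂(ν : Measure (Space d)) := by
  have hnorm : inner ℝ (θ : Space d) (θ : Space d) = (1 : ℝ) := by
    rw [real_inner_self_eq_norm_sq, norm_eq_of_mem_sphere, one_pow]
  -- The test function is the restriction of `v ↦ wave r ⟨v, θ⟩` to the lines, so it matches at
  -- glued points, which are equal in `ℝ^d`.
  have key := sum_integral_eq_of_wasserstein_eq_zero hG α h
    (H := fun i t => wave r (inner ℝ (L.lines i).1 (θ : Space d) + t)) (K := Real.nnabs r) (C := 1)
    (fun i => by
      have := (lipschitzWith_wave r).comp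
        (LipschitzWith.of_dist_le_mul (K := 1) (f := fun t : ℝ =>
          inner ℝ (L.lines i).1 (θ : Space d) + t) fun s t => by simp)
      rwa [mul_one] at this)
    (fun i t => (norm_wave _ _).le)
    (fun i j hij => by
      have := congrArg (fun v => inner ℝ v (θ : Space d)) (L.2.1 i j hij)
      have hi := hθ i
      have hj := hθ j
      simp only [TreeSystem.lines] at hi hj
      simp only [hi, hj, inner_add_left, inner_smul_left, hnorm] at this
      simp only [TreeSystem.lines, TreeSystem.param]
      congr 1
      simpa using this)
  have e : ∀ ρ : ProbabilityMeasure (Space d),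
      ∑ i, ∫ y, (α (y, L.lines)).1 i • wave r (inner ℝ (L.lines i).1 (θ : Space d) +
        inner ℝ (y - (L.lines i).1) ((L.lines i).2 : Space d)) ∂(ρ : Measure (Space d)) =
      ∫ y, wave r (inner ℝ y (θ : Space d)) ∂(ρ : Measure (Space d)) := by
    intro ρ
    simp only [hθ, ← inner_add_left, add_sub_cancel]
    have hw := (lipschitzWith_wave r).continuous
    rw [← integral_finsetSum]
    · simp only [← Finset.sum_smul, α.sum_coord, one_smul]
    · intro i _
      refine Integrable.of_bound ((α.continuous_coord_left L.lines i).smul (hw.comp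
        (continuous_id.inner continuous_const))).aestronglyMeasurable 1
        (Eventually.of_forall fun y => ?_)
      rw [norm_smul, norm_wave, mul_one, Real.norm_of_nonneg (α.coord_nonneg _ i)]
      exact α.coord_le_one _ i
  rw [← e μ, ← e ν]
  exact key

/-- For a single line of the system, test functions which vanish at the gluing points are
allowed. -/
lemma integral_cutoff_eq (hG : G.IsTree) (α : SplittingMap d k)
    {L : TreeSystem d G} {μ ν : ProbabilityMeasure (Space d)}
    (h : wasserstein L.treeDist (radon α L.lines (μ : Measure (Space d)))
      (radon α L.lines (ν : Measure (Space d))) = 0) (i : Fin k)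
    {χ : ℝ → ℝ} (hχ : LipschitzWith 1 χ) (h0 : ∀ t, 0 ≤ χ t)
    (h1 : ∀ t, χ t ≤ 1) (hχ0 : ∀ j, χ (L.param i j) = 0) (r : ℝ) :
    ∫ y, (α (y, L.lines)).1 i • (χ (inner ℝ (y - (L.lines i).1) ((L.lines i).2 : Space d)) *
        wave r (inner ℝ (y - (L.lines i).1) ((L.lines i).2 : Space d))) ∂(μ : Measure (Space d)) =
    ∫ y, (α (y, L.lines)).1 i • (χ (inner ℝ (y - (L.lines i).1) ((L.lines i).2 : Space d)) *
        wave r (inner ℝ (y - (L.lines i).1) ((L.lines i).2 : Space d)))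
          ∂(ν : Measure (Space d)) := by
  have hval : ∀ (a b : Fin k), (if a = i then fun t => (χ t : ℂ) * wave r t else 0)
      (L.param a b) = 0 := fun a b => by
    split_ifs with ha
    · subst ha
      simp [hχ0]
    · rfl
  have key := sum_integral_eq_of_wasserstein_eq_zero hG α h
    (H := fun j => if j = i then fun t => (χ t : ℂ) * wave r t else 0)
    (K := 1 + Real.nnabs r) (C := 1)
    (fun j => by
      split_ifs
      · exact lipschitzWith_mul_wave hχ h0 h1 r
      · exact (LipschitzWith.const 0).weaken zero_le)
    (fun j t => by
      split_ifs
      · rw [norm_mul, norm_wave, mul_one, Complex.norm_real, Real.norm_of_nonneg (h0 t)]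
        exact h1 t
      · simp)
    (fun a b _ => (hval a b).trans (hval b a).symm)
  rw [Finset.sum_eq_single i, Finset.sum_eq_single i] at key
  · simpa using key
  all_goals simp +contextual

/-- Euclidean motions `y ↦ Q (y + a)` with `Q φ = θ`, the direction of line `i`, turn the cut-off
wave on that line into a constant phase times `F (Q (y + a))` times the wave in direction `φ`.
Letting `a` vary gives all translates of `F ∘ Q`. -/
lemma integral_wave_eq_of_orbit (hG : G.IsTree) {α : SplittingMap d k} (hα : α.IsInvariant)
    {L : TreeSystem d G} {μ ν : ProbabilityMeasure (Space d)}
    (h : ∀ g : EuclideanGroup d, wasserstein (L.act g).treeDist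
      (radon α (L.act g).lines (μ : Measure (Space d)))
      (radon α (L.act g).lines (ν : Measure (Space d))) = 0)
    (φ : Metric.sphere (0 : Space d) 1) (r : ℝ) :
    ∫ y, wave r (inner ℝ y (φ : Space d)) ∂(μ : Measure (Space d)) =
      ∫ y, wave r (inner ℝ y (φ : Space d)) ∂(ν : Measure (Space d)) := by
  obtain ⟨i, hi⟩ : ∃ i, 0 < (α (0, L.lines)).1 i := by
    by_contra! hcon
    have := Finset.sum_nonpos fun i (_ : i ∈ Finset.univ) => hcon i
    rw [α.sum_coord] at this
    linarith
  set x : Space d := (L.lines i).1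
  set θ : Space d := ((L.lines i).2 : Space d)
  have hθn : ‖θ‖ = 1 := norm_eq_of_mem_sphere _
  have hθθ : inner ℝ θ θ = (1 : ℝ) := by rw [real_inner_self_eq_norm_sq, hθn, one_pow]
  set S : Set ℝ := Set.range (L.param i)
  have hSfin : S.Finite := Set.finite_range _
  -- `S` also contains the default value `L.param i i = 0`, so it is nonempty even for a single
  -- line. This matters: `Metric.infDist` to the empty set is `0`, which would make `χ` vanish.
  have hSne : S.Nonempty := ⟨_, i, rfl⟩
  set χ : ℝ → ℝ := fun t => min 1 (Metric.infDist t S) with hχdef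
  have hχ : LipschitzWith 1 χ := (Metric.lipschitz_infDist_pt S).const_min 1
  have h0 : ∀ t, 0 ≤ χ t := fun t => le_min zero_le_one Metric.infDist_nonneg
  have h1 : ∀ t, χ t ≤ 1 := fun t => min_le_left _ _
  have hχ0 : ∀ j, χ (L.param i j) = 0 := fun j => by
    simp [hχdef, Metric.infDist_zero_of_mem (show L.param i j ∈ S from ⟨j, rfl⟩)]
  set F : Space d → ℝ := fun y => (α (y, L.lines)).1 i * χ (inner ℝ (y - x) θ) with hFdef
  have hαi := α.continuous_coord_left L.lines i
  have hχc := hχ.continuous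
  have hF : Continuous F := hαi.mul (by fun_prop)
  have hF0 : ∀ y, 0 ≤ F y := fun y => mul_nonneg (α.coord_nonneg _ i) (h0 _)
  have hF1 : ∀ y, F y ≤ 1 := fun y => mul_le_one₀ (α.coord_le_one _ i) (h0 _) (h1 _)
  -- Along `t • θ` the weight `α_i` stays positive near `t = 0`, while only finitely many `t`
  -- project to a point of `S`.
  obtain ⟨w, hw⟩ : ∃ w, F w ≠ 0 := by
    have hopen : {t : ℝ | 0 < (α (t • θ, L.lines)).1 i} ∈ 𝓝 (0 : ℝ) := by
      have hc : Continuous fun t : ℝ => (α (t • θ, L.lines)).1 i :=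
        hαi.comp (continuous_id.smul continuous_const)
      refine (isOpen_lt continuous_const hc).mem_nhds ?_
      simpa using hi
    obtain ⟨t, ht, htS⟩ := ((infinite_of_mem_nhds 0 hopen).sdiff
      (hSfin.image fun s => s + inner ℝ x θ)).nonempty
    refine ⟨t • θ, (mul_pos ht (lt_min one_pos ?_)).ne'⟩
    refine (hSfin.isClosed.notMem_iff_infDist_pos hSne).1 fun hmem => htS ⟨_, hmem, ?_⟩
    simp only [inner_sub_left, inner_smul_left, hθθ]
    simp
  set Q : Space d ≃ₗᵢ[ℝ] Space d := (ℝ ∙ ((φ : Space d) - θ))ᗮ.reflection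
  have hQφ : Q φ = θ := Submodule.reflection_sub (by rw [hθn, norm_eq_of_mem_sphere])
  have hwave : Continuous (wave r) := (lipschitzWith_wave r).continuous
  refine integral_eq_of_forall_translate (F := fun y => F (Q y)) (C := 1) (z := Q.symm w)
    (hF.comp Q.continuous) (fun y => hF0 _) (fun y => hF1 _) (by simpa using hw)
    (by fun_prop) (D := 1) (fun y => (norm_wave _ _).le) fun a => ?_
  set e : EuclideanGroup d :=
    (AffineIsometryEquiv.constVAdd ℝ (Space d) a).trans Q.toAffineIsometryEquiv
  have he' : ∀ y, e y = Q (y + a) := fun y => by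
    rw [add_comm]
    rfl
  have hpush : ∀ ρ : ProbabilityMeasure (Space d), push e.symm (push e ρ) = ρ := fun ρ => by
    refine Subtype.ext ?_
    change ((ρ : Measure (Space d)).map e).map e.symm = ρ
    rw [Measure.map_map e.symm.continuous.measurable e.continuous.measurable,
      show e.symm ∘ e = id from funext e.symm_apply_apply, Measure.map_id]
  have hzero := h e.symm
  -- Writing `μ` and `ν` as pushforwards under `e.symm` transfers the motion from the system to the
  -- measures.
  rw [← hpush μ, ← hpush ν, wasserstein_act hα] at hzero
  have key := integral_cutoff_eq hG α hzero i hχ h0 h1 hχ0 r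
  have hρ : ∀ ρ : ProbabilityMeasure (Space d),
      ∫ y, (α (y, L.lines)).1 i • ((χ (inner ℝ (y - x) θ) : ℂ) * wave r (inner ℝ (y - x) θ))
        ∂(push e ρ : Measure (Space d)) =
      wave r (inner ℝ (Q a - x) θ) *
        ∫ y, F (Q (y + a)) • wave r (inner ℝ y (φ : Space d)) ∂(ρ : Measure (Space d)) := by
    intro ρ
    have hcont : Continuous fun y => (α (y, L.lines)).1 i •
        ((χ (inner ℝ (y - x) θ) : ℂ) * wave r (inner ℝ (y - x) θ)) := hαi.smul (by fun_prop)
    rw [push, ProbabilityMeasure.toMeasure_map, integral_map e.continuous.measurable.aemeasurable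
      hcont.aestronglyMeasurable, ← integral_const_mul]
    refine integral_congr_ae (Eventually.of_forall fun y => ?_)
    have hin : inner ℝ (Q (y + a) - x) θ = inner ℝ (Q a - x) θ + inner ℝ y (φ : Space d) := by
      rw [map_add, add_sub_assoc, inner_add_left, add_comm, ← Q.inner_map_map y, hQφ]
    simp only [he', hFdef]
    rw [hin, wave_add, Complex.real_smul, Complex.real_smul]
    push_cast
    ring
  have hne : wave r (inner ℝ (Q a - x) θ) ≠ 0 := by
    rw [← norm_ne_zero_iff, norm_wave]
    exact one_ne_zero
  exact mul_left_cancel₀ hne ((hρ μ).symm.trans (key.trans (hρ ν)))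

/-! ### Finiteness -/

lemma lintegral_enorm_radon_le (α : SplittingMap d k) (L : LineSystem d k)
    (μ : Measure (Space d)) [IsProbabilityMeasure μ] :
    ∫⁻ z, ‖z.2‖ₑ ∂(radon α L μ) ≤ k * ∫⁻ y, ‖y‖ₑ ∂μ + ∑ i, ‖(L i).1‖ₑ := by
  rw [lintegral_radon α L μ (by fun_prop)]
  calc ∑ i, ∫⁻ y, ENNReal.ofReal ((α (y, L)).1 i) * ‖(lineProj L i y).2‖ₑ ∂μ
      ≤ ∑ i, ∫⁻ y, (‖y‖ₑ + ‖(L i).1‖ₑ) ∂μ := by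
        refine Finset.sum_le_sum fun i _ => lintegral_mono fun y => ?_
        have hα : ENNReal.ofReal ((α (y, L)).1 i) ≤ 1 := by
          rw [ENNReal.ofReal_le_one]; exact α.coord_le_one _ i
        refine (mul_le_of_le_one_left zero_le hα).trans
          (le_trans ?_ (enorm_sub_le (a := y) (b := (L i).1)))
        rw [enorm_le_iff_norm_le]
        refine (norm_inner_le_norm _ _).trans ?_
        rw [norm_eq_of_mem_sphere, mul_one]
    _ = _ := by
        simp only [lintegral_add_right _ measurable_const, lintegral_const, measure_univ, mul_one,
          Finset.sum_add_distrib, Finset.sum_const, Finset.card_univ, Fintype.card_fin,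
          nsmul_eq_mul]

lemma exists_treeDist_le (d : ℕ) (hG : G.IsTree) : ∃ N : ℕ, ∀ (L : TreeSystem d G)
    (p q : Ground k), L.treeDist p q ≤
      ‖p.2‖ₑ + ‖q.2‖ₑ + N * ∑ a, ∑ b, ‖L.param a b‖ₑ := by
  choose w hw using exists_isPath hG
  refine ⟨∑ i, ∑ j, 2 * (w i j).length, fun L p q => ?_⟩
  refine ((iInf_le _ (w p.1 q.1)).trans (L.routeLength_le _ _ _)).trans ?_
  gcongr
  exact (Finset.single_le_sum (f := fun j => 2 * (w p.1 j).length) (fun _ _ => Nat.zero_le _)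
      (Finset.mem_univ q.1)).trans
    (Finset.single_le_sum (f := fun i => ∑ j, 2 * (w i j).length) (fun _ _ => Nat.zero_le _)
      (Finset.mem_univ p.1))

lemma exists_wasserstein_radon_le (hG : G.IsTree) (α : SplittingMap d k) : ∃ N : ℕ,
    ∀ (L : TreeSystem d G) (μ ν : ProbabilityMeasure (Space d)),
      wasserstein L.treeDist (radon α L.lines (μ : Measure (Space d)))
        (radon α L.lines (ν : Measure (Space d))) ≤
      (k * ∫⁻ y, ‖y‖ₑ ∂(μ : Measure (Space d)) + k * ∫⁻ y, ‖y‖ₑ ∂(ν : Measure (Space d))) +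
        N * ‖∑ i, ‖(L.lines i).1‖ + ∑ i, ∑ j, |L.param i j|‖ₑ := by
  obtain ⟨N, hN⟩ := exists_treeDist_le d hG
  -- The estimate gives `2 * X + N * S`; the coefficient `N + 2` serves both sums, with surplus `N *
  -- X + 2 * S`.
  refine ⟨N + 2, fun L μ ν => ?_⟩
  set P := radon α L.lines (μ : Measure (Space d))
  set P' := radon α L.lines (ν : Measure (Space d))
  set X := ∑ i, ‖(L.lines i).1‖ₑ
  set S := ∑ a, ∑ b, ‖L.param a b‖ₑ
  have hXS : ‖∑ i, ‖(L.lines i).1‖ + ∑ i, ∑ j, |L.param i j|‖ₑ = X + S := by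
    rw [Real.enorm_of_nonneg (by positivity), ENNReal.ofReal_add (by positivity) (by positivity),
      ENNReal.ofReal_sum_of_nonneg (fun _ _ => by positivity),
      ENNReal.ofReal_sum_of_nonneg (fun _ _ => by positivity)]
    congr 1
    · exact Finset.sum_congr rfl fun i _ => ofReal_norm _
    · refine Finset.sum_congr rfl fun i _ => ?_
      rw [ENNReal.ofReal_sum_of_nonneg (fun _ _ => by positivity)]
      exact Finset.sum_congr rfl fun j _ => by rw [← Real.norm_eq_abs, ofReal_norm]
  -- The product coupling suffices, since the tree metric is bounded by a sum of terms in one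
  -- variable each and a constant.
  calc wasserstein L.treeDist P P' ≤ ∫⁻ z, L.treeDist z.1 z.2 ∂(P.prod P') :=
        wasserstein_le_lintegral _ _ (by simp [Measure.map_fst_prod])
          (by simp [Measure.map_snd_prod])
    _ ≤ ∫⁻ z, (‖z.1.2‖ₑ + ‖z.2.2‖ₑ + N * S) ∂(P.prod P') := lintegral_mono fun z => hN L _ _
    _ = ∫⁻ z, ‖z.2‖ₑ ∂P + ∫⁻ z, ‖z.2‖ₑ ∂P' + N * S := by
        rw [lintegral_add_right _ measurable_const, lintegral_add_left (by fun_prop),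
          lintegral_prod _ (by fun_prop), lintegral_prod _ (by fun_prop)]
        simp
    _ ≤ (k * ∫⁻ y, ‖y‖ₑ ∂(μ : Measure (Space d)) + X) +
        (k * ∫⁻ y, ‖y‖ₑ ∂(ν : Measure (Space d)) + X) + N * S := by
        gcongr
        · exact lintegral_enorm_radon_le α L.lines _
        · exact lintegral_enorm_radon_le α L.lines _
    _ ≤ (k * ∫⁻ y, ‖y‖ₑ ∂(μ : Measure (Space d)) + X) +
        (k * ∫⁻ y, ‖y‖ₑ ∂(ν : Measure (Space d)) + X) + N * S + (N * X + 2 * S) := le_self_add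
    _ = _ := by
        rw [hXS]
        push_cast
        ring

/-! ### Invariance -/

lemma continuous_act (g : EuclideanGroup d) :
    Continuous (TreeSystem.act g : TreeSystem d G → TreeSystem d G) := by
  have hline : Continuous (actLine g : Line d → Line d) :=
    (g.continuous.comp continuous_fst).prodMk
      ((g.linearIsometryEquiv.continuous.comp
        (continuous_subtype_val.comp continuous_snd)).subtype_mk _)
  refine Continuous.subtype_mk (Continuous.prodMk (continuous_pi fun i => ?_)
    (continuous_snd.comp continuous_subtype_val)) _
  exact hline.comp ((continuous_apply i).comp (continuous_fst.comp continuous_subtype_val))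

end TreeSliced

end

open TreeSliced in
theorem theorem5p2 (d k : ℕ) (G : SimpleGraph (Fin k)) (hG : G.IsTree)
    (α : SplittingMap d k) (hα : α.IsInvariant)
    (σ : Measure (TreeSystem d G)) (T : Set (TreeSystem d G)) (hTσ : T ⊆ σ.support)
    (hT : (T.Nonempty ∧ ∀ (g : EuclideanGroup d), ∀ L ∈ T, L.act g ∈ T) ∨
      ∀ θ : Metric.sphere (0 : Space d) 1, ∃ L ∈ T, ∀ i, (L.lines i).2 = θ) :
    -- `dbTSW` is a metric on the probability measures, with values in `[0, ∞]`
    (∀ μ ν, dbTSW α σ μ ν = 0 ↔ μ = ν) ∧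
    (∀ μ ν, dbTSW α σ μ ν = dbTSW α σ ν μ) ∧
    (∀ μ₁ μ₂ μ₃, dbTSW α σ μ₁ μ₃ ≤ dbTSW α σ μ₁ μ₂ + dbTSW α σ μ₂ μ₃) ∧
    -- it is finite on the measures with finite first moment
    (IsFiniteMeasure σ →
      Integrable (fun L : TreeSystem d G =>
        ∑ i, ‖(L.lines i).1‖ + ∑ i, ∑ j, |L.param i j|) σ →
      ∀ μ ν : ProbabilityMeasure (Space d),
        Integrable (fun x => ‖x‖) (μ : Measure (Space d)) →
        Integrable (fun x => ‖x‖) (ν : Measure (Space d)) → dbTSW α σ μ ν < ∞) ∧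
    -- it is invariant under the Euclidean transformations that preserve `σ`
    (∀ g : EuclideanGroup d, σ.map (TreeSystem.act g) = σ →
      ∀ μ ν, dbTSW α σ (push g μ) (push g ν) = dbTSW α σ μ ν) := by
  have hmeas : ∀ L : TreeSystem d G,
      Measurable fun z : Ground k × Ground k => L.treeDist z.1 z.2 := fun L =>
    ((TreeSystem.continuous_treeDist hG).comp
      (continuous_const.prodMk continuous_id : Continuous fun z => (L, z))).measurable
  refine ⟨fun μ ν => ⟨fun h => ?_, ?_⟩, fun μ ν => ?_, fun μ₁ μ₂ μ₃ => ?_,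
    fun hσ hint μ ν hμ hν => ?_, fun g hg μ ν => ?_⟩
  · refine eq_of_forall_integral_wave fun θ r => ?_
    rcases hT with ⟨⟨L, hL⟩, hinv⟩ | hdir
    · exact integral_wave_eq_of_orbit hG hα (fun g =>
        wasserstein_eq_zero_of_mem_support hG α h (hTσ (hinv g L hL))) θ r
    · obtain ⟨L, hL, hθ⟩ := hdir θ
      exact integral_wave_eq_of_common_direction hG α hθ
        (wasserstein_eq_zero_of_mem_support hG α h (hTσ hL)) r
  · rintro rfl
    simp only [dbTSW, wasserstein_self (hmeas _) (TreeSystem.treeDist_self _), lintegral_zero]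
  · exact lintegral_congr fun L => wasserstein_comm (hmeas L) L.treeDist_comm _ _
  · rw [dbTSW, dbTSW, dbTSW, ← lintegral_add_left (measurable_wasserstein_radon hG α μ₁ μ₂)]
    exact lintegral_mono fun L => wasserstein_triangle (hmeas L) L.treeDist_triangle _ _ _
  · obtain ⟨N, hN⟩ := exists_wasserstein_radon_le hG α
    have hmom : ∀ ρ : ProbabilityMeasure (Space d),
        Integrable (fun x => ‖x‖) (ρ : Measure (Space d)) →
        ∫⁻ y, ‖y‖ₑ ∂(ρ : Measure (Space d)) < ∞ := fun ρ h => by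
      simpa [HasFiniteIntegral] using h.2
    refine (lintegral_mono fun L => hN L μ ν).trans_lt ?_
    rw [lintegral_add_left measurable_const, lintegral_const,
      lintegral_const_mul' _ _ (ENNReal.natCast_ne_top N)]
    have h1 := hmom μ hμ
    have h2 := hmom ν hν
    have h3 : ∫⁻ L : TreeSystem d G, ‖∑ i, ‖(L.lines i).1‖ + ∑ i, ∑ j, |L.param i j|‖ₑ ∂σ < ∞ :=
      hint.2
    finiteness
  · have hm := measurable_wasserstein_radon hG α (push g μ) (push g ν)
    calc dbTSW α σ (push g μ) (push g ν) =
          dbTSW α (σ.map (TreeSystem.act g)) (push g μ) (push g ν) := by rw [hg]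
      _ = ∫⁻ L, wasserstein (L.act g).treeDist
            (radon α (L.act g).lines (push g μ : Measure (Space d)))
            (radon α (L.act g).lines (push g ν : Measure (Space d))) ∂σ :=
          lintegral_map hm (continuous_act g).measurable
      _ = dbTSW α σ μ ν := lintegral_congr fun L => wasserstein_act hα g L μ ν
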